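/- Let $M$ be a smooth ($C^\infty$), finite-dimensional, Hausdorff, second countable manifold without boundary, and let $\pi:E\to M$ be a smooth real vector bundle of finite rank. For open $U\subseteq M$ let $\Gamma^\infty(\pi^{-1}(U))$ be the set of smooth sections of $E$ over $U$, i.e. of smooth maps $\sigma:U\to E$ with $\pi\circ\sigma=\mathrm{id}_U$; in particular $\Gamma^\infty(E)=\Gamma^\infty(\pi^{-1}(M))$. Topologies. Let $f:U\to E$ be smooth, let $\varphi$, $\psi$ be smooth charts of $U$ and of $E$, let $K$ be a compact subset of the domain of $\varphi$ such that $f(K)$ lies in the domain of $\psi$, and let $r\in\mathbb{N}$, $\varepsilon>0$. Write $\mathcal{N}^r(f;\varphi,\psi,K,\varepsilon)$ for the set of smooth $g:U\to E$ such that $g(K)$ lies in the domain of $\psi$ and $\|D^k(\psi g\varphi^{-1})(\varphi(x))-D^k(\psi f\varphi^{-1})(\varphi(x))\|<\varepsilon$ for all $x\in K$ and $0\le k\le r$. The weak topology on $C^\infty(U,E)$ is generated by all sets $\mathcal{N}^r(f;\varphi,\psi,K,\varepsilon)$. The strong topology is generated by all sets $\bigcap_{j}\mathcal{N}^{r_j}(f;\varphi_j,\psi_j,K_j,\varepsilon_j)$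 with $\{K_j\}$ a locally finite family in $U$ (the order $r_j$ and the bound $\varepsilon_j$ may depend on $j$). The set $\Gamma^\infty(\pi^{-1}(U))\subseteq C^\infty(U,E)$ carries the two relative topologies, and "strongly" and "weakly" refer to these. A smooth class of sections of $E$ is a family $\mathcal{X}$ of subsets $\mathcal{X}(U)\subseteq\Gamma^\infty(\pi^{-1}(U))$, one for each open $U\subseteq M$, such that 1. if $W\subseteq U\subseteq M$ are open and $\sigma\in\mathcal{X}(U)$, then $\sigma|_W\in\mathcal{X}(W)$; 2. if $\sigma\in\Gamma^\infty(E)$ and there is an open cover $\{U_i\}$ of $M$ such that $\sigma|_{U_i}\in\mathcal{X}(U_i)$ for all $i$, then $\sigma\in\mathcal{X}(M)$. Globalisation lemma. Let $\mathcal{X}$ be a smooth class of sections of $E$. If there is an open cover $\mathcal{U}$ of $M$ such that, for every open subset $U$ of an element of $\mathcal{U}$, the set $\mathcal{X}(U)$ is strongly open in $\Gamma^\infty(\pi^{-1}(U))$, then $\mathcal{X}(M)$ is strongly open in $\Gamma^\infty(E)$. If in addition each such $\mathcal{X}(U)$ is weakly dense in $\Gamma^\infty(\pi^{-1}(U))$,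 then $\mathcal{X}(M)$ is also strongly dense in $\Gamma^\infty(E)$. -/

import Mathlib

open Bundle Set TopologicalSpace
open scoped Manifold ContDiff Bundle Topology

universe u

noncomputable section

namespace SmoothMaps

variable {EM : Type*} [NormedAddCommGroup EM] [NormedSpace ℝ EM]
  {HM : Type*} [TopologicalSpace HM] (I : ModelWithCorners ℝ EM HM)
  {EN : Type*} [NormedAddCommGroup EN] [NormedSpace ℝ EN]
  {HN : Type*} [TopologicalSpace HN] (J : ModelWithCorners ℝ EN HN)
  (M : Type u) [TopologicalSpace M] [ChartedSpace HM M]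
  (N : Type*) [TopologicalSpace N] [ChartedSpace HN N]

/-- The local representative `ψ ∘ g ∘ φ⁻¹` of a map `g : M → N`. -/
def localRep {M N : Type*} [TopologicalSpace M] [TopologicalSpace N]
    (φ : OpenPartialHomeomorph M HM) (ψ : OpenPartialHomeomorph N HN) (g : M → N) : EM → EN :=
  ψ.extend J ∘ g ∘ (φ.extend I).symm

/-- `𝒩^r(f; φ, ψ, K, ε)`: the smooth maps `g` which send `K` into the domain of `ψ` and all of
whose partial derivatives of order at most `r`, in the charts `φ` and `ψ`, differ from those of `f`
by less than `ε` at every point of `K`. -/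
def derivNhd {M N : Type*} [TopologicalSpace M] [ChartedSpace HM M] [TopologicalSpace N]
    [ChartedSpace HN N] (f : C^∞⟮I, M; J, N⟯)
    (φ : OpenPartialHomeomorph M HM) (ψ : OpenPartialHomeomorph N HN)
    (K : Set M) (r : ℕ) (ε : ℝ) : Set C^∞⟮I, M; J, N⟯ :=
  {g | MapsTo g K ψ.source ∧ ∀ k ≤ r, ∀ x ∈ K,
    ‖iteratedFDeriv ℝ k (localRep I J φ ψ g) (φ.extend I x) -
      iteratedFDeriv ℝ k (localRep I J φ ψ f) (φ.extend I x)‖ < ε}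

/-- The data `(φ, ψ, K, ε)` is admissible at `f`: `φ` and `ψ` are smooth charts, `K` is a compact
subset of the domain of `φ` which `f` maps into the domain of `ψ`, and `ε > 0`. -/
def Admissible {M N : Type*} [TopologicalSpace M] [ChartedSpace HM M] [TopologicalSpace N]
    [ChartedSpace HN N] (f : C^∞⟮I, M; J, N⟯)
    (φ : OpenPartialHomeomorph M HM) (ψ : OpenPartialHomeomorph N HN)
    (K : Set M) (ε : ℝ) : Prop :=
  φ ∈ IsManifold.maximalAtlas I ∞ M ∧ ψ ∈ IsManifold.maximalAtlas J ∞ N ∧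
    IsCompact K ∧ K ⊆ φ.source ∧ MapsTo f K ψ.source ∧ 0 < ε

/-- The weak (compact-open `C^∞`) topology on `C^∞(M, N)`. -/
@[reducible]
def weakTopology : TopologicalSpace C^∞⟮I, M; J, N⟯ :=
  TopologicalSpace.generateFrom
    {S | ∃ (f : C^∞⟮I, M; J, N⟯) (φ : OpenPartialHomeomorph M HM)
        (ψ : OpenPartialHomeomorph N HN) (K : Set M) (r : ℕ) (ε : ℝ),
      Admissible I J f φ ψ K ε ∧ S = derivNhd I J f φ ψ K r ε}

/-- The strong topology on `C^∞(M, N)`: a basic neighbourhood of `f` is given by a family of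
restrictions on derivatives on the members of a locally finite family of compact sets. Each member
`K i` carries its own order `r i` of differentiation and its own bound `ε i`. -/
@[reducible]
def strongTopology : TopologicalSpace C^∞⟮I, M; J, N⟯ :=
  TopologicalSpace.generateFrom
    {S | ∃ (f : C^∞⟮I, M; J, N⟯) (ι : Type u) (φ : ι → OpenPartialHomeomorph M HM)
        (ψ : ι → OpenPartialHomeomorph N HN) (K : ι → Set M) (r : ι → ℕ) (ε : ι → ℝ),
      LocallyFinite K ∧ (∀ i, Admissible I J f (φ i) (ψ i) (K i) (ε i)) ∧
        S = ⋂ i, derivNhd I J f (φ i) (ψ i) (K i) (r i) (ε i)}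

end SmoothMaps

namespace SmoothSections

variable {EM : Type*} [NormedAddCommGroup EM] [NormedSpace ℝ EM]
  {HM : Type*} [TopologicalSpace HM] (I : ModelWithCorners ℝ EM HM)
  {M : Type u} [TopologicalSpace M] [ChartedSpace HM M]
  (F : Type*) [NormedAddCommGroup F] [NormedSpace ℝ F]
  (V : M → Type*) [TopologicalSpace (TotalSpace F V)] [∀ x, TopologicalSpace (V x)]
  [FiberBundle F V]

/-- `Γ^∞(π⁻¹(U))`: the smooth sections over the open set `U` of the bundle `π : E → M`, where
`E = TotalSpace F V`. They are the smooth maps `σ : U → E` with `π (σ x) = x`. -/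
def LocalSection (U : Opens M) : Type _ :=
  {σ : C^∞⟮I, U; I.prod 𝓘(ℝ, F), TotalSpace F V⟯ // ∀ x : U, (σ x).proj = x}

/-- The strong topology on `Γ^∞(π⁻¹(U))`, inherited from `C^∞(U, E)`. -/
@[reducible]
def strongTopology (U : Opens M) : TopologicalSpace (LocalSection I F V U) :=
  (SmoothMaps.strongTopology I (I.prod 𝓘(ℝ, F)) U (TotalSpace F V)).induced Subtype.val

/-- The weak topology on `Γ^∞(π⁻¹(U))`, inherited from `C^∞(U, E)`. -/
@[reducible]
def weakTopology (U : Opens M) : TopologicalSpace (LocalSection I F V U) :=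
  (SmoothMaps.weakTopology I (I.prod 𝓘(ℝ, F)) U (TotalSpace F V)).induced Subtype.val

variable {I F V}

/-- The restriction `σ|_W` of a section over `U` to an open subset `W ⊆ U`. -/
def LocalSection.restrict {U W : Opens M} (h : W ≤ U) (σ : LocalSection I F V U) :
    LocalSection I F V W :=
  ⟨⟨σ.1 ∘ Opens.inclusion h, σ.1.contMDiff.comp (contMDiff_inclusion h)⟩,
    fun x => σ.2 (Opens.inclusion h x)⟩

/-- A smooth class of sections: sets `𝒳(U) ⊆ Γ^∞(π⁻¹(U))`, one for each open `U ⊆ M`, subject to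
the localisation axioms. The whole manifold is the open set `⊤`. -/
structure IsSmoothClass (X : ∀ U : Opens M, Set (LocalSection I F V U)) : Prop where
  restrict_mem : ∀ (U W : Opens M) (h : W ≤ U), ∀ σ ∈ X U, σ.restrict h ∈ X W
  mem_of_cover : ∀ (σ : LocalSection I F V (⊤ : Opens M)) (𝒱 : Set (Opens M)), sSup 𝒱 = ⊤ →
    (∀ W ∈ 𝒱, σ.restrict (le_top : W ≤ ⊤) ∈ X W) → σ ∈ X ⊤

/-- `S` is strongly open in `Γ^∞(π⁻¹(U))`. -/
def StronglyOpen {U : Opens M} (S : Set (LocalSection I F V U)) : Prop :=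
  IsOpen[strongTopology I F V U] S

/-- `S` is strongly dense in `Γ^∞(π⁻¹(U))`. -/
def StronglyDense {U : Opens M} (S : Set (LocalSection I F V U)) : Prop :=
  @Dense _ (strongTopology I F V U) S

/-- `S` is weakly dense in `Γ^∞(π⁻¹(U))`. -/
def WeaklyDense {U : Opens M} (S : Set (LocalSection I F V U)) : Prop :=
  @Dense _ (weakTopology I F V U) S

end SmoothSections

end

/-! Convergence is expressed through jets. For maps `g a`, `JetTendsto` along `l ×ˢ 𝓝 x₀` lets the
map and the base point vary together, which is locally uniform convergence of all derivatives. By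
Faà di Bruno's formula it is stable under composition, hence can be tested in any smooth charts.
Weak convergence implies it at every point. Together with agreement with the limit off a fixed
compact set it implies strong convergence, because a locally finite family has only finitely many
members meeting that set.

Restriction from `M` to `U` need not be strongly continuous: a family locally finite in `U` may
accumulate at the boundary. The remedy is blending. If `ρ` is a bump function with compact support
in `U`, then `s + ρ • (t - s)` is `s` off the support and `t` where `ρ = 1`, and it tends strongly
to `s` when the jets of `t` tend to those of `s` on the support.

Openness (`eventually_restrict_mem`, `stronglyOpen_top`): for `σ` in `X ⊤`, closeness to `σ` on the
support of one bump function forces membership in `X` where that function is `1`. Imposing this for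
a locally finite bump covering defines a strong neighbourhood of `σ`, which the gluing axiom places
in `X ⊤`.

Density (`exists_perturbation`, `stronglyDense_top`): the covering is countable, and `σ` is
corrected on one support at a time. Weak density supplies the correction; openness over a smaller
set supplies a neighbourhood that protects it from later steps. The corrections are locally finite,
so the sequence is locally eventually constant, and its limit inherits every condition that depends
on germs along a compact set. -/

noncomputable section

open Filter

/-! ### Jets of compositions in normed spaces -/

section NormedSpaceJets

variable {α E F G : Type*} [NormedAddCommGroup E] [NormedSpace ℝ E]
  [NormedAddCommGroup F] [NormedSpace ℝ F] [NormedAddCommGroup G] [NormedSpace ℝ G]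

/-- If all derivatives of `v a` at `x a` converge to those of `v₀` at `x₀`, and all derivatives of
`u a` at `v a (x a)` converge to those of `u₀` at `v₀ x₀`, then all derivatives of `u a ∘ v a` at
`x a` converge to those of `u₀ ∘ v₀` at `x₀`. -/
theorem tendsto_iteratedFDeriv_comp {l : Filter α} {x : α → E} {x₀ : E} {v : α → E → F}
    {v₀ : E → F} {u : α → F → G} {u₀ : F → G}
    (hu : ∀ᶠ a in l, ContDiffAt ℝ ∞ (u a) (v a (x a))) (hu₀ : ContDiffAt ℝ ∞ u₀ (v₀ x₀))
    (hv : ∀ᶠ a in l, ContDiffAt ℝ ∞ (v a) (x a)) (hv₀ : ContDiffAt ℝ ∞ v₀ x₀)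
    (hut : ∀ k, Tendsto (fun a => iteratedFDeriv ℝ k (u a) (v a (x a))) l
      (𝓝 (iteratedFDeriv ℝ k u₀ (v₀ x₀))))
    (hvt : ∀ k, Tendsto (fun a => iteratedFDeriv ℝ k (v a) (x a)) l
      (𝓝 (iteratedFDeriv ℝ k v₀ x₀))) (k : ℕ) :
    Tendsto (fun a => iteratedFDeriv ℝ k (u a ∘ v a) (x a)) l
      (𝓝 (iteratedFDeriv ℝ k (u₀ ∘ v₀) x₀)) := by
  have hk : ((k : ℕ) : WithTop ℕ∞) ≤ ∞ := by exact_mod_cast le_top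
  rw [iteratedFDeriv_comp hu₀ hv₀ hk]
  have heq : (fun a => (ftaylorSeries ℝ (u a) (v a (x a))).taylorComp
      (ftaylorSeries ℝ (v a) (x a)) k) =ᶠ[l]
      fun a => iteratedFDeriv ℝ k (u a ∘ v a) (x a) := by
    filter_upwards [hu, hv] with a h1 h2
    rw [iteratedFDeriv_comp h1 h2 hk]
  refine Tendsto.congr' heq ?_
  -- Faà di Bruno: a finite sum over ordered partitions, each term jointly continuous in the
  -- derivatives of the two maps.
  unfold FormalMultilinearSeries.taylorComp
  refine tendsto_finsetSum _ fun c _ => ?_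
  exact ((c.compAlongOrderedFinpartitionL ℝ E F G).continuous_uncurry_of_multilinear.tendsto
    (iteratedFDeriv ℝ c.length u₀ (v₀ x₀), fun i => iteratedFDeriv ℝ (c.partSize i) v₀ x₀)).comp
    ((hut c.length).prodMk_nhds (tendsto_pi_nhds.2 fun i => hvt (c.partSize i)))

theorem ContDiffAt.tendsto_iteratedFDeriv {f : E → F} {x₀ : E} (hf : ContDiffAt ℝ ∞ f x₀) (k : ℕ) :
    Tendsto (iteratedFDeriv ℝ k f) (𝓝 x₀) (𝓝 (iteratedFDeriv ℝ k f x₀)) :=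
  (hf.iteratedFDeriv_right (m := 0) (i := k)
    (by rw [zero_add]; exact_mod_cast le_top)).continuousAt

end NormedSpaceJets

/-! ### Convergence of jets on manifolds -/

section ManifoldJets

variable {α β : Type*}
  {E₁ : Type*} [NormedAddCommGroup E₁] [NormedSpace ℝ E₁]
  {H₁ : Type*} [TopologicalSpace H₁] (I₁ : ModelWithCorners ℝ E₁ H₁)
  {M₁ : Type*} [TopologicalSpace M₁] [ChartedSpace H₁ M₁]
  {E₂ : Type*} [NormedAddCommGroup E₂] [NormedSpace ℝ E₂]
  {H₂ : Type*} [TopologicalSpace H₂] (I₂ : ModelWithCorners ℝ E₂ H₂)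
  {M₂ : Type*} [TopologicalSpace M₂] [ChartedSpace H₂ M₂]
  {E₃ : Type*} [NormedAddCommGroup E₃] [NormedSpace ℝ E₃]
  {H₃ : Type*} [TopologicalSpace H₃] (I₃ : ModelWithCorners ℝ E₃ H₃)
  {M₃ : Type*} [TopologicalSpace M₃] [ChartedSpace H₃ M₃]

/-- Along the filter `l`, the points `x a` converge to `x₀` and the infinite jets of the maps `u a`
at `x a` converge to the infinite jet of `u₀` at `x₀`. -/
structure JetTendsto (l : Filter α) (x : α → M₁) (u : α → M₁ → M₂) (x₀ : M₁) (u₀ : M₁ → M₂) :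
    Prop where
  tendsto_base : Tendsto x l (𝓝 x₀)
  smooth_limit : ContMDiffAt I₁ I₂ ∞ u₀ x₀
  eventually_smooth : ∀ᶠ a in l, ContMDiffAt I₁ I₂ ∞ (u a) (x a)
  tendsto_value : Tendsto (fun a => u a (x a)) l (𝓝 (u₀ x₀))
  tendsto_jet : ∀ k : ℕ, Tendsto (fun a => iteratedFDeriv ℝ k
      (extChartAt I₂ (u₀ x₀) ∘ u a ∘ (extChartAt I₁ x₀).symm) (extChartAt I₁ x₀ (x a))) l
    (𝓝 (iteratedFDeriv ℝ k
      (extChartAt I₂ (u₀ x₀) ∘ u₀ ∘ (extChartAt I₁ x₀).symm) (extChartAt I₁ x₀ x₀)))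

variable {I₁ I₂ I₃}

theorem ContMDiffAt.contDiffAt_extChartAt [IsManifold I₁ ∞ M₁] [IsManifold I₂ ∞ M₂]
    [I₁.Boundaryless] {f : M₁ → M₂} {x x' : M₁} {y : M₂} (hf : ContMDiffAt I₁ I₂ ∞ f x')
    (hx : x' ∈ (extChartAt I₁ x).source) (hy : f x' ∈ (extChartAt I₂ y).source) :
    ContDiffAt ℝ ∞ (extChartAt I₂ y ∘ f ∘ (extChartAt I₁ x).symm) (extChartAt I₁ x x') := by
  rw [extChartAt_source] at hx hy
  have := ((contMDiffAt_iff_of_mem_source hx hy).1 hf).2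
  rwa [I₁.range_eq_univ, contDiffWithinAt_univ] at this

theorem tendsto_extChartAt_symm {x x' : M₁} (hx : x' ∈ (extChartAt I₁ x).source) :
    Tendsto (extChartAt I₁ x).symm (𝓝 (extChartAt I₁ x x')) (𝓝 x') := by
  have := continuousAt_extChartAt_symm' (I := I₁) hx
  rwa [ContinuousAt, (extChartAt I₁ x).left_inv hx] at this

namespace JetTendsto

theorem of_const [IsManifold I₁ ∞ M₁] [IsManifold I₂ ∞ M₂] [I₁.Boundaryless]
    {l : Filter α} {x : α → M₁} {x₀ : M₁} {f : M₁ → M₂}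
    (hf : ∀ᶠ y in 𝓝 x₀, ContMDiffAt I₁ I₂ ∞ f y) (hx : Tendsto x l (𝓝 x₀)) :
    JetTendsto I₁ I₂ l x (fun _ => f) x₀ f where
  tendsto_base := hx
  smooth_limit := hf.self_of_nhds
  eventually_smooth := hx.eventually hf
  tendsto_value := hf.self_of_nhds.continuousAt.tendsto.comp hx
  tendsto_jet k := (hf.self_of_nhds.contDiffAt_extChartAt (mem_extChartAt_source _)
    (mem_extChartAt_source _)).tendsto_iteratedFDeriv k |>.comp
      ((continuousAt_extChartAt x₀).tendsto.comp hx)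

theorem congr {l : Filter α} {x : α → M₁} {x₀ : M₁} {u u' : α → M₁ → M₂} {u₀ : M₁ → M₂}
    (h : JetTendsto I₁ I₂ l x u x₀ u₀) (hu : ∀ᶠ a in l, u' a =ᶠ[𝓝 (x a)] u a) :
    JetTendsto I₁ I₂ l x u' x₀ u₀ where
  tendsto_base := h.tendsto_base
  smooth_limit := h.smooth_limit
  eventually_smooth := by
    filter_upwards [h.eventually_smooth, hu] with a h1 h2 using h1.congr_of_eventuallyEq h2
  tendsto_value := h.tendsto_value.congr' <| by
    filter_upwards [hu] with a h2 using h2.self_of_nhds.symm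
  tendsto_jet k := (h.tendsto_jet k).congr' <| by
    filter_upwards [hu, h.tendsto_base.eventually (extChartAt_source_mem_nhds (I := I₁) x₀)]
      with a h2 h3
    refine (Filter.EventuallyEq.iteratedFDeriv ℝ ?_ k).self_of_nhds
    filter_upwards [(tendsto_extChartAt_symm h3).eventually h2] with y hy
    simp only [Function.comp_apply, hy]

theorem congr_limit {l : Filter α} {x : α → M₁} {x₀ : M₁} {u : α → M₁ → M₂} {u₀ u₀' : M₁ → M₂}
    (h : JetTendsto I₁ I₂ l x u x₀ u₀) (hu : u₀' =ᶠ[𝓝 x₀] u₀) :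
    JetTendsto I₁ I₂ l x u x₀ u₀' where
  tendsto_base := h.tendsto_base
  smooth_limit := h.smooth_limit.congr_of_eventuallyEq hu
  eventually_smooth := h.eventually_smooth
  tendsto_value := by rw [hu.self_of_nhds]; exact h.tendsto_value
  tendsto_jet k := by
    have : iteratedFDeriv ℝ k (extChartAt I₂ (u₀' x₀) ∘ u₀' ∘ (extChartAt I₁ x₀).symm)
        (extChartAt I₁ x₀ x₀) = iteratedFDeriv ℝ k
        (extChartAt I₂ (u₀ x₀) ∘ u₀ ∘ (extChartAt I₁ x₀).symm) (extChartAt I₁ x₀ x₀) := by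
      rw [hu.self_of_nhds]
      refine (Filter.EventuallyEq.iteratedFDeriv ℝ ?_ k).self_of_nhds
      filter_upwards [(tendsto_extChartAt_symm (mem_extChartAt_source x₀)).eventually hu] with y hy
      simp only [Function.comp_apply, hy]
    rw [this, hu.self_of_nhds]
    exact h.tendsto_jet k

theorem congr_base {l : Filter α} {x x' : α → M₁} {x₀ : M₁} {u : α → M₁ → M₂} {u₀ : M₁ → M₂}
    (h : JetTendsto I₁ I₂ l x u x₀ u₀) (hx : x' =ᶠ[l] x) :
    JetTendsto I₁ I₂ l x' u x₀ u₀ where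
  tendsto_base := h.tendsto_base.congr' hx.symm
  smooth_limit := h.smooth_limit
  eventually_smooth := by
    filter_upwards [h.eventually_smooth, hx] with a h1 h2 using h2 ▸ h1
  tendsto_value := h.tendsto_value.congr' <| by
    filter_upwards [hx] with a h2 using by rw [h2]
  tendsto_jet k := (h.tendsto_jet k).congr' <| by
    filter_upwards [hx] with a h2 using by rw [h2]

theorem comp_filter {l : Filter α} {x : α → M₁} {x₀ : M₁} {u : α → M₁ → M₂} {u₀ : M₁ → M₂}
    (h : JetTendsto I₁ I₂ l x u x₀ u₀) {m : Filter β} {g : β → α} (hg : Tendsto g m l) :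
    JetTendsto I₁ I₂ m (x ∘ g) (u ∘ g) x₀ u₀ where
  tendsto_base := h.tendsto_base.comp hg
  smooth_limit := h.smooth_limit
  eventually_smooth := hg.eventually h.eventually_smooth
  tendsto_value := h.tendsto_value.comp hg
  tendsto_jet k := (h.tendsto_jet k).comp hg

theorem mono {l l' : Filter α} {x : α → M₁} {x₀ : M₁} {u : α → M₁ → M₂} {u₀ : M₁ → M₂}
    (h : JetTendsto I₁ I₂ l x u x₀ u₀) (hl : l' ≤ l) : JetTendsto I₁ I₂ l' x u x₀ u₀ :=
  h.comp_filter (g := id) hl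

/-- Allows separate arguments for base points on and off the support of a bump function. -/
theorem sup {l l' : Filter α} {x : α → M₁} {x₀ : M₁} {u : α → M₁ → M₂} {u₀ : M₁ → M₂}
    (h : JetTendsto I₁ I₂ l x u x₀ u₀) (h' : JetTendsto I₁ I₂ l' x u x₀ u₀) :
    JetTendsto I₁ I₂ (l ⊔ l') x u x₀ u₀ where
  tendsto_base := h.tendsto_base.sup h'.tendsto_base
  smooth_limit := h.smooth_limit
  eventually_smooth := eventually_sup.2 ⟨h.eventually_smooth, h'.eventually_smooth⟩
  tendsto_value := h.tendsto_value.sup h'.tendsto_value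
  tendsto_jet k := (h.tendsto_jet k).sup (h'.tendsto_jet k)

theorem comp [IsManifold I₁ ∞ M₁] [IsManifold I₂ ∞ M₂] [IsManifold I₃ ∞ M₃]
    [I₁.Boundaryless] [I₂.Boundaryless]
    {l : Filter α} {x : α → M₁} {x₀ : M₁} {v : α → M₁ → M₂} {v₀ : M₁ → M₂}
    {u : α → M₂ → M₃} {u₀ : M₂ → M₃}
    (hu : JetTendsto I₂ I₃ l (fun a => v a (x a)) u (v₀ x₀) u₀)
    (hv : JetTendsto I₁ I₂ l x v x₀ v₀) :
    JetTendsto I₁ I₃ l x (fun a => u a ∘ v a) x₀ (u₀ ∘ v₀) where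
  tendsto_base := hv.tendsto_base
  smooth_limit := hu.smooth_limit.comp _ hv.smooth_limit
  eventually_smooth := by
    filter_upwards [hu.eventually_smooth, hv.eventually_smooth] with a h1 h2 using h1.comp _ h2
  tendsto_value := hu.tendsto_value
  tendsto_jet k := by
    have hx := hv.tendsto_base.eventually (extChartAt_source_mem_nhds (I := I₁) x₀)
    have hy := hv.tendsto_value.eventually (extChartAt_source_mem_nhds (I := I₂) (v₀ x₀))
    have hz := hu.tendsto_value.eventually (extChartAt_source_mem_nhds (I := I₃) (u₀ (v₀ x₀)))
    -- The chart expression of a composite factors through the middle chart as long as the middle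
    -- value stays in its domain; continuity ensures this near the base point.
    have key : ∀ {x : M₁} {v : M₁ → M₂} (u : M₂ → M₃), x ∈ (extChartAt I₁ x₀).source →
        v x ∈ (extChartAt I₂ (v₀ x₀)).source → ContMDiffAt I₁ I₂ ∞ v x →
        (extChartAt I₃ (u₀ (v₀ x₀)) ∘ (u ∘ v) ∘ (extChartAt I₁ x₀).symm)
          =ᶠ[𝓝 (extChartAt I₁ x₀ x)]
        (extChartAt I₃ (u₀ (v₀ x₀)) ∘ u ∘ (extChartAt I₂ (v₀ x₀)).symm) ∘
          (extChartAt I₂ (v₀ x₀) ∘ v ∘ (extChartAt I₁ x₀).symm) := by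
      intro x v u h1 h2 h3
      have h4 : ∀ᶠ y in 𝓝 x, v y ∈ (extChartAt I₂ (v₀ x₀)).source :=
        h3.continuousAt.eventually (extChartAt_source_mem_nhds' (I := I₂) h2)
      filter_upwards [(tendsto_extChartAt_symm h1).eventually h4] with y hy
      simp only [Function.comp_apply]
      rw [(extChartAt I₂ (v₀ x₀)).left_inv hy]
    have hval : ∀ (v : M₁ → M₂) {x : M₁}, x ∈ (extChartAt I₁ x₀).source →
        (extChartAt I₂ (v₀ x₀) ∘ v ∘ (extChartAt I₁ x₀).symm) (extChartAt I₁ x₀ x) =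
          extChartAt I₂ (v₀ x₀) (v x) := by
      intro v x h1
      simp only [Function.comp_apply]
      rw [(extChartAt I₁ x₀).left_inv h1]
    have hx₀ := mem_extChartAt_source (I := I₁) x₀
    have hy₀ := mem_extChartAt_source (I := I₂) (v₀ x₀)
    have hz₀ := mem_extChartAt_source (I := I₃) (u₀ (v₀ x₀))
    simp only [Function.comp_apply (f := u₀) (g := v₀)]
    rw [((key u₀ hx₀ hy₀ hv.smooth_limit).iteratedFDeriv ℝ k).self_of_nhds]
    have heq : ∀ᶠ a in l, iteratedFDeriv ℝ k
        ((extChartAt I₃ (u₀ (v₀ x₀)) ∘ u a ∘ (extChartAt I₂ (v₀ x₀)).symm) ∘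
          (extChartAt I₂ (v₀ x₀) ∘ v a ∘ (extChartAt I₁ x₀).symm)) (extChartAt I₁ x₀ (x a)) =
        iteratedFDeriv ℝ k (extChartAt I₃ (u₀ (v₀ x₀)) ∘ (u a ∘ v a) ∘ (extChartAt I₁ x₀).symm)
          (extChartAt I₁ x₀ (x a)) := by
      filter_upwards [hx, hy, hv.eventually_smooth] with a h1 h2 h3
      exact ((key (u a) h1 h2 h3).iteratedFDeriv ℝ k).self_of_nhds.symm
    refine Tendsto.congr' heq (tendsto_iteratedFDeriv_comp ?_ ?_ ?_ ?_ ?_ hv.tendsto_jet k)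
    · filter_upwards [hx, hy, hz, hu.eventually_smooth] with a h1 h2 h3 h4
      rw [hval (v a) h1]
      exact h4.contDiffAt_extChartAt h2 h3
    · rw [hval v₀ hx₀]
      exact hu.smooth_limit.contDiffAt_extChartAt hy₀ hz₀
    · filter_upwards [hx, hy, hv.eventually_smooth] with a h1 h2 h3
      exact h3.contDiffAt_extChartAt h1 h2
    · exact hv.smooth_limit.contDiffAt_extChartAt hx₀ hy₀
    · intro j
      rw [hval v₀ hx₀]
      refine (hu.tendsto_jet j).congr' ?_
      filter_upwards [hx] with a h1
      rw [hval (v a) h1]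

/-- Composition with a fixed smooth map on the left. -/
theorem comp_left [IsManifold I₁ ∞ M₁] [IsManifold I₂ ∞ M₂] [IsManifold I₃ ∞ M₃]
    [I₁.Boundaryless] [I₂.Boundaryless]
    {l : Filter α} {x : α → M₁} {x₀ : M₁} {v : α → M₁ → M₂} {v₀ : M₁ → M₂}
    (hv : JetTendsto I₁ I₂ l x v x₀ v₀) {h : M₂ → M₃}
    (hh : ∀ᶠ y in 𝓝 (v₀ x₀), ContMDiffAt I₂ I₃ ∞ h y) :
    JetTendsto I₁ I₃ l x (fun a => h ∘ v a) x₀ (h ∘ v₀) :=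
  (of_const hh hv.tendsto_value).comp hv

/-- Composition with a fixed smooth map on the right. -/
theorem comp_right [IsManifold I₁ ∞ M₁] [IsManifold I₂ ∞ M₂] [IsManifold I₃ ∞ M₃]
    [I₁.Boundaryless] [I₂.Boundaryless]
    {l : Filter α} {x : α → M₁} {x₀ : M₁} {h : M₁ → M₂} {u : α → M₂ → M₃} {u₀ : M₂ → M₃}
    (hu : JetTendsto I₂ I₃ l (fun a => h (x a)) u (h x₀) u₀)
    (hh : ∀ᶠ y in 𝓝 x₀, ContMDiffAt I₁ I₂ ∞ h y) (hx : Tendsto x l (𝓝 x₀)) :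
    JetTendsto I₁ I₃ l x (fun a => u a ∘ h) x₀ (u₀ ∘ h) :=
  hu.comp (of_const hh hx)

theorem iff_of_normedSpace {l : Filter α} {x : α → E₁} {x₀ : E₁} {u : α → E₁ → E₂}
    {u₀ : E₁ → E₂} :
    JetTendsto 𝓘(ℝ, E₁) 𝓘(ℝ, E₂) l x u x₀ u₀ ↔
      Tendsto x l (𝓝 x₀) ∧ ContDiffAt ℝ ∞ u₀ x₀ ∧ (∀ᶠ a in l, ContDiffAt ℝ ∞ (u a) (x a)) ∧
      ∀ k : ℕ, Tendsto (fun a => iteratedFDeriv ℝ k (u a) (x a)) l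
        (𝓝 (iteratedFDeriv ℝ k u₀ x₀)) := by
  constructor
  · rintro ⟨h1, h2, h3, -, h5⟩
    refine ⟨h1, contMDiffAt_iff_contDiffAt.1 h2, ?_, fun k => ?_⟩
    · simpa only [contMDiffAt_iff_contDiffAt] using h3
    · simpa only [extChartAt_model_space_eq_id, PartialEquiv.refl_coe, PartialEquiv.refl_symm,
        Function.id_comp, Function.comp_id, id_eq] using h5 k
  · rintro ⟨h1, h2, h3, h5⟩
    refine ⟨h1, contMDiffAt_iff_contDiffAt.2 h2, ?_, ?_, fun k => ?_⟩
    · simpa only [contMDiffAt_iff_contDiffAt] using h3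
    -- Convergence of values is the case of order zero.
    · exact ((continuousMultilinearCurryFin0 ℝ E₁ E₂).continuous.tendsto _).comp (h5 0)
    · simpa only [extChartAt_model_space_eq_id, PartialEquiv.refl_coe, PartialEquiv.refl_symm,
        Function.id_comp, Function.comp_id, id_eq] using h5 k

end JetTendsto

end ManifoldJets

/-- A form of the tube lemma: finitely many of the local conditions cover `K`. -/
theorem IsCompact.eventually_forall_mem_of_prod {α X : Type*} [TopologicalSpace X] {K : Set X}
    (hK : IsCompact K) {l : Filter α} {P : α → X → Prop}
    (h : ∀ x ∈ K, ∀ᶠ p in l ×ˢ 𝓝 x, P p.1 p.2) : ∀ᶠ a in l, ∀ᶠ x in 𝓝ˢ K, P a x :=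
  Eventually.curry (hK.mem_prod_nhdsSet_of_forall h)

/-! ### Weak and strong topologies in terms of jets -/

namespace SmoothMaps

variable {α : Type*} {EM : Type*} [NormedAddCommGroup EM] [NormedSpace ℝ EM]
  {HM : Type*} [TopologicalSpace HM] {I : ModelWithCorners ℝ EM HM}
  {EN : Type*} [NormedAddCommGroup EN] [NormedSpace ℝ EN]
  {HN : Type*} [TopologicalSpace HN] {J : ModelWithCorners ℝ EN HN}
  {M : Type u} [TopologicalSpace M] {N : Type*} [TopologicalSpace N]

theorem tendsto_extend_symm {φ : OpenPartialHomeomorph M HM} {x : M} (hx : x ∈ φ.source) :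
    Tendsto (φ.extend I).symm (𝓝 (φ.extend I x)) (𝓝 x) := by
  have := φ.continuousAt_extend_symm (I := I) hx
  rwa [ContinuousAt, φ.extend_left_inv hx] at this

theorem localRep_eventuallyEq {φ : OpenPartialHomeomorph M HM} {ψ : OpenPartialHomeomorph N HN}
    {g g' : M → N} {x : M} (hx : x ∈ φ.source) (h : g =ᶠ[𝓝 x] g') :
    localRep I J φ ψ g =ᶠ[𝓝 (φ.extend I x)] localRep I J φ ψ g' := by
  filter_upwards [(tendsto_extend_symm (I := I) hx).eventually h] with y hy
  simp only [localRep, Function.comp_apply, hy]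

variable [ChartedSpace HM M] [ChartedSpace HN N]

theorem eventually_contMDiffAt_extend {φ : OpenPartialHomeomorph M HM}
    (hφ : φ ∈ IsManifold.maximalAtlas I ∞ M) {x : M} (hx : x ∈ φ.source) :
    ∀ᶠ y in 𝓝 x, ContMDiffAt I 𝓘(ℝ, EM) ∞ (φ.extend I) y := by
  filter_upwards [φ.open_source.mem_nhds hx] with y hy using φ.contMDiffAt_extend hφ hy

theorem eventually_contMDiffAt_extend_symm [I.Boundaryless] {φ : OpenPartialHomeomorph M HM}
    (hφ : φ ∈ IsManifold.maximalAtlas I ∞ M) {x : M} (hx : x ∈ φ.source) :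
    ∀ᶠ y in 𝓝 (φ.extend I x), ContMDiffAt 𝓘(ℝ, EM) I ∞ (φ.extend I).symm y := by
  have ho : IsOpen (I '' φ.target) := by
    rw [← φ.extend_target']
    exact φ.isOpen_extend_target
  have hm : φ.extend I x ∈ I '' φ.target := ⟨φ x, φ.map_source hx, rfl⟩
  filter_upwards [ho.mem_nhds hm] with y hy
  exact (contMDiffOn_extend_symm hφ).contMDiffAt (ho.mem_nhds hy)

/-- Membership in `derivNhd` depends only on the germs of a map along `K`. -/
theorem mem_derivNhd_of_eventuallyEq {f g g' : C^∞⟮I, M; J, N⟯}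
    {φ : OpenPartialHomeomorph M HM} {ψ : OpenPartialHomeomorph N HN} {K : Set M} {r : ℕ} {ε : ℝ}
    (hK : K ⊆ φ.source) (hg : g ∈ derivNhd I J f φ ψ K r ε)
    (h : ∀ x ∈ K, (g' : M → N) =ᶠ[𝓝 x] g) : g' ∈ derivNhd I J f φ ψ K r ε := by
  refine ⟨fun x hx => ?_, fun k hk x hx => ?_⟩
  · rw [(h x hx).self_of_nhds]
    exact hg.1 hx
  · rw [((localRep_eventuallyEq (I := I) (J := J) (ψ := ψ) (hK hx)
      (h x hx)).iteratedFDeriv ℝ k).self_of_nhds]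
    exact hg.2 k hk x hx

theorem strongTopology_le_weakTopology :
    strongTopology I J M N ≤ weakTopology I J M N := by
  refine le_generateFrom ?_
  rintro _ ⟨f, φ, ψ, K, r, ε, had, rfl⟩
  refine isOpen_generateFrom_of_mem ⟨f, PUnit, fun _ => φ, fun _ => ψ, fun _ => K, fun _ => r,
    fun _ => ε, locallyFinite_of_finite _, fun _ => had, ?_⟩
  exact (iInter_const _).symm

variable [I.Boundaryless] [J.Boundaryless] [IsManifold I ∞ M] [IsManifold J ∞ N]

theorem jetTendsto_localRep {l : Filter α} {x : α → M} {x₀ : M} {u : α → M → N} {u₀ : M → N}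
    {φ : OpenPartialHomeomorph M HM} {ψ : OpenPartialHomeomorph N HN}
    (hφ : φ ∈ IsManifold.maximalAtlas I ∞ M) (hψ : ψ ∈ IsManifold.maximalAtlas J ∞ N)
    (hx₀ : x₀ ∈ φ.source) (hu₀ : u₀ x₀ ∈ ψ.source) (h : JetTendsto I J l x u x₀ u₀) :
    JetTendsto 𝓘(ℝ, EM) 𝓘(ℝ, EN) l (fun a => φ.extend I (x a))
      (fun a => localRep I J φ ψ (u a)) (φ.extend I x₀) (localRep I J φ ψ u₀) := by
  have h1 := h.comp_left (eventually_contMDiffAt_extend hψ hu₀)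
  have hs : ∀ᶠ a in l, x a ∈ φ.source := h.tendsto_base.eventually (φ.open_source.mem_nhds hx₀)
  have h2 : JetTendsto I 𝓘(ℝ, EN) l (fun a => (φ.extend I).symm (φ.extend I (x a)))
      (fun a => ψ.extend J ∘ u a) ((φ.extend I).symm (φ.extend I x₀)) (ψ.extend J ∘ u₀) := by
    rw [φ.extend_left_inv hx₀]
    refine h1.congr_base ?_
    filter_upwards [hs] with a ha using φ.extend_left_inv ha
  exact h2.comp_right (eventually_contMDiffAt_extend_symm hφ hx₀)
    ((φ.continuousAt_extend hx₀).tendsto.comp h.tendsto_base)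

/-- Each map is locally `ψ⁻¹ ∘ localRep ∘ φ`, so stability under composition applies. Continuity is
assumed in order that nearby values remain in the domain of `ψ`. -/
theorem jetTendsto_of_localRep {l : Filter α} {x : α → M} {x₀ : M} {u : α → M → N} {u₀ : M → N}
    {φ : OpenPartialHomeomorph M HM} {ψ : OpenPartialHomeomorph N HN}
    (hφ : φ ∈ IsManifold.maximalAtlas I ∞ M) (hψ : ψ ∈ IsManifold.maximalAtlas J ∞ N)
    (hx₀ : x₀ ∈ φ.source) (hu₀ : u₀ x₀ ∈ ψ.source) (hc₀ : ContinuousAt u₀ x₀)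
    (hx : Tendsto x l (𝓝 x₀)) (hc : ∀ᶠ a in l, ContinuousAt (u a) (x a))
    (hu : ∀ᶠ a in l, u a (x a) ∈ ψ.source)
    (h : JetTendsto 𝓘(ℝ, EM) 𝓘(ℝ, EN) l (fun a => φ.extend I (x a))
      (fun a => localRep I J φ ψ (u a)) (φ.extend I x₀) (localRep I J φ ψ u₀)) :
    JetTendsto I J l x u x₀ u₀ := by
  have key : ∀ {v : M → N} {y : M}, y ∈ φ.source → v y ∈ ψ.source → ContinuousAt v y →
      v =ᶠ[𝓝 y] (ψ.extend J).symm ∘ localRep I J φ ψ v ∘ φ.extend I := by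
    intro v y h1 h2 h3
    filter_upwards [φ.open_source.mem_nhds h1, h3.eventually (ψ.open_source.mem_nhds h2)]
      with z h4 h5
    simp only [localRep, Function.comp_apply]
    rw [φ.extend_left_inv h4, ψ.extend_left_inv h5]
  have hval : localRep I J φ ψ u₀ (φ.extend I x₀) = ψ.extend J (u₀ x₀) := by
    simp only [localRep, Function.comp_apply]
    rw [φ.extend_left_inv hx₀]
  have h1 : JetTendsto 𝓘(ℝ, EM) J l (fun a => φ.extend I (x a))
      (fun a => (ψ.extend J).symm ∘ localRep I J φ ψ (u a)) (φ.extend I x₀)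
      ((ψ.extend J).symm ∘ localRep I J φ ψ u₀) := by
    refine h.comp_left ?_
    rw [hval]
    exact eventually_contMDiffAt_extend_symm hψ hu₀
  refine ((h1.comp_right (eventually_contMDiffAt_extend hφ hx₀) hx).congr ?_).congr_limit ?_
  · filter_upwards [hc, hu, hx.eventually (φ.open_source.mem_nhds hx₀)] with a h2 h3 h4
      using key h4 h3 h2
  · exact key hx₀ hu₀ hc₀

/-- Convergence in the neighbourhoods `derivNhd` over `K` implies convergence of jets at the points
of `K`. -/
theorem jetTendsto_of_eventually_mem_derivNhd {l : Filter α} {g : α → C^∞⟮I, M; J, N⟯}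
    {g₀ : C^∞⟮I, M; J, N⟯} {φ : OpenPartialHomeomorph M HM} {ψ : OpenPartialHomeomorph N HN}
    {K : Set M} (hφ : φ ∈ IsManifold.maximalAtlas I ∞ M)
    (hψ : ψ ∈ IsManifold.maximalAtlas J ∞ N) (hK : K ⊆ φ.source) (hg₀ : MapsTo g₀ K ψ.source)
    (h : ∀ n : ℕ, ∀ᶠ a in l, g a ∈ derivNhd I J g₀ φ ψ K n (1 / ((n : ℝ) + 1)))
    {x₀ : M} (hx₀ : x₀ ∈ K) :
    JetTendsto I J (l ×ˢ 𝓝[K] x₀) Prod.snd (fun p => g p.1) x₀ g₀ := by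
  have hsnd : Tendsto (Prod.snd : α × M → M) (l ×ˢ 𝓝[K] x₀) (𝓝 x₀) :=
    tendsto_snd.mono_right nhdsWithin_le_nhds
  have hmemK : ∀ᶠ p : α × M in l ×ˢ 𝓝[K] x₀, p.2 ∈ K :=
    tendsto_snd.eventually self_mem_nhdsWithin
  have hmem : ∀ n : ℕ, ∀ᶠ p : α × M in l ×ˢ 𝓝[K] x₀,
      g p.1 ∈ derivNhd I J g₀ φ ψ K n (1 / ((n : ℝ) + 1)) :=
    fun n => tendsto_fst.eventually (h n)
  have hrep : ∀ {v : C^∞⟮I, M; J, N⟯} {y : M}, y ∈ φ.source → v y ∈ ψ.source →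
      ContDiffAt ℝ ∞ (localRep I J φ ψ v) (φ.extend I y) := by
    intro v y h1 h2
    have hy : (φ.extend I).symm (φ.extend I y) = y := φ.extend_left_inv h1
    refine contMDiffAt_iff_contDiffAt.1 ?_
    refine ContMDiffAt.comp (I' := J) _ ?_ (ContMDiffAt.comp (I' := I) _ v.contMDiff.contMDiffAt
      (eventually_contMDiffAt_extend_symm hφ h1).self_of_nhds)
    simp only [Function.comp_apply, hy]
    exact ψ.contMDiffAt_extend hψ h2
  refine jetTendsto_of_localRep hφ hψ (hK hx₀) (hg₀ hx₀) g₀.contMDiff.continuous.continuousAt hsnd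
    (Eventually.of_forall fun p => (g p.1).contMDiff.continuous.continuousAt) ?_ ?_
  · filter_upwards [hmem 0, hmemK] with p h1 h2 using h1.1 h2
  refine JetTendsto.iff_of_normedSpace.2
    ⟨(φ.continuousAt_extend (hK hx₀)).tendsto.comp hsnd, hrep (hK hx₀) (hg₀ hx₀), ?_, fun k => ?_⟩
  · filter_upwards [hmem 0, hmemK] with p h1 h2 using hrep (hK h2) (h1.1 h2)
  have hlim : Tendsto (fun p : α × M =>
      iteratedFDeriv ℝ k (localRep I J φ ψ g₀) (φ.extend I p.2)) (l ×ˢ 𝓝[K] x₀)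
      (𝓝 (iteratedFDeriv ℝ k (localRep I J φ ψ g₀) (φ.extend I x₀))) :=
    ((hrep (hK hx₀) (hg₀ hx₀)).tendsto_iteratedFDeriv k).comp
      ((φ.continuousAt_extend (hK hx₀)).tendsto.comp hsnd)
  have hdiff : Tendsto (fun p : α × M =>
      iteratedFDeriv ℝ k (localRep I J φ ψ (g p.1)) (φ.extend I p.2) -
      iteratedFDeriv ℝ k (localRep I J φ ψ g₀) (φ.extend I p.2)) (l ×ˢ 𝓝[K] x₀) (𝓝 0) := by
    rw [Metric.tendsto_nhds]
    intro ε hε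
    -- A single index bounds both order and tolerance, so `max n k` serves for the order `k` and for
    -- `ε`.
    obtain ⟨n, hn⟩ := exists_nat_one_div_lt hε
    filter_upwards [hmem (max n k), hmemK] with p h1 h2
    rw [dist_zero_right]
    refine (h1.2 k (le_max_right _ _) _ h2).trans (lt_of_le_of_lt ?_ hn)
    refine one_div_le_one_div_of_le (by positivity) ?_
    have : (n : ℝ) ≤ ((max n k : ℕ) : ℝ) := by exact_mod_cast le_max_left _ _
    linarith
  simpa using hdiff.add hlim

/-- Convergence of jets at all points of the compact set `K` implies that the maps eventually lie
in a neighbourhood `derivNhd` containing the limit. -/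
theorem eventually_mem_derivNhd {l : Filter α} {g : α → C^∞⟮I, M; J, N⟯}
    {f g₀ : C^∞⟮I, M; J, N⟯} {φ : OpenPartialHomeomorph M HM} {ψ : OpenPartialHomeomorph N HN}
    {K : Set M} {r : ℕ} {ε : ℝ} (had : Admissible I J f φ ψ K ε)
    (hg₀ : g₀ ∈ derivNhd I J f φ ψ K r ε)
    (h : ∀ x₀ ∈ K, JetTendsto I J (l ×ˢ 𝓝 x₀) Prod.snd (fun p => g p.1) x₀ g₀) :
    ∀ᶠ a in l, g a ∈ derivNhd I J f φ ψ K r ε := by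
  obtain ⟨hφ, hψ, hKc, hK, hf, -⟩ := had
  have key : ∀ x₀ ∈ K, ∀ᶠ p : α × M in l ×ˢ 𝓝 x₀, g p.1 p.2 ∈ ψ.source ∧
      ∀ k ≤ r, ‖iteratedFDeriv ℝ k (localRep I J φ ψ (g p.1)) (φ.extend I p.2) -
        iteratedFDeriv ℝ k (localRep I J φ ψ f) (φ.extend I p.2)‖ < ε := by
    intro x₀ hx₀
    have h1 := h x₀ hx₀
    have h2 := (JetTendsto.iff_of_normedSpace.1
      (jetTendsto_localRep hφ hψ (hK hx₀) (hg₀.1 hx₀) h1)).2.2.2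
    -- The centre `f` may differ from the limit `g₀`. Derivatives of both `g a` and `f` converge, so
    -- the strict inequality at `x₀` persists nearby.
    have h3 := (JetTendsto.iff_of_normedSpace.1 (jetTendsto_localRep hφ hψ (hK hx₀) (hf hx₀)
      (JetTendsto.of_const (I₁ := I) (I₂ := J)
        (Eventually.of_forall fun y => f.contMDiff.contMDiffAt) h1.tendsto_base))).2.2.2
    have h4 : ∀ᶠ p : α × M in l ×ˢ 𝓝 x₀, ∀ k ∈ Finset.range (r + 1),
        ‖iteratedFDeriv ℝ k (localRep I J φ ψ (g p.1)) (φ.extend I p.2) -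
        iteratedFDeriv ℝ k (localRep I J φ ψ f) (φ.extend I p.2)‖ < ε := by
      rw [Filter.eventually_all_finset]
      intro k hk
      exact ((h2 k).sub (h3 k)).norm.eventually
        (Iio_mem_nhds (hg₀.2 k (Nat.lt_succ_iff.1 (Finset.mem_range.1 hk)) x₀ hx₀))
    filter_upwards [h1.tendsto_value.eventually (ψ.open_source.mem_nhds (hg₀.1 hx₀)), h4]
      with p h5 h6
    exact ⟨h5, fun k hk => h6 k (Finset.mem_range.2 (Nat.lt_succ_of_le hk))⟩
  have key' := hKc.eventually_forall_mem_of_prod (l := l) (P := fun a x =>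
    g a x ∈ ψ.source ∧ ∀ k ≤ r, ‖iteratedFDeriv ℝ k (localRep I J φ ψ (g a)) (φ.extend I x) -
        iteratedFDeriv ℝ k (localRep I J φ ψ f) (φ.extend I x)‖ < ε)
    key
  filter_upwards [key'] with a ha
  have ha' := fun x hx => ha.self_of_nhdsSet x hx
  exact ⟨fun x hx => (ha' x hx).1, fun k hk x hx => (ha' x hx).2 k hk⟩

/-- Convergence in the weak topology implies convergence of jets. -/
theorem jetTendsto_of_tendsto_weakTopology [LocallyCompactSpace M]
    {l : Filter α} {g : α → C^∞⟮I, M; J, N⟯} {g₀ : C^∞⟮I, M; J, N⟯}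
    (h : Tendsto g l (@nhds _ (weakTopology I J M N) g₀)) (x₀ : M) :
    JetTendsto I J (l ×ˢ 𝓝 x₀) Prod.snd (fun p => g p.1) x₀ g₀ := by
  have hU : (chartAt HM x₀).source ∩ g₀ ⁻¹' (chartAt HN (g₀ x₀)).source ∈ 𝓝 x₀ :=
    inter_mem ((chartAt HM x₀).open_source.mem_nhds (mem_chart_source _ _))
      (g₀.contMDiff.continuous.continuousAt
        ((chartAt HN (g₀ x₀)).open_source.mem_nhds (mem_chart_source _ _)))
  obtain ⟨K, hKn, hKU, hKc⟩ := LocallyCompactSpace.local_compact_nhds x₀ _ hU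
  have := jetTendsto_of_eventually_mem_derivNhd (l := l) (g := g) (g₀ := g₀) (K := K)
    (IsManifold.chart_mem_maximalAtlas (I := I) x₀)
    (IsManifold.chart_mem_maximalAtlas (I := J) (g₀ x₀))
    (fun y hy => (hKU hy).1) (fun y hy => (hKU hy).2) (fun n => ?_) (mem_of_mem_nhds hKn)
  · rwa [nhdsWithin_eq_nhds.2 hKn] at this
  · have hpos : (0 : ℝ) < 1 / ((n : ℝ) + 1) := by positivity
    refine h.eventually ?_
    refine (@IsOpen.mem_nhds _ (weakTopology I J M N) _ _ (isOpen_generateFrom_of_mem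
      ⟨g₀, _, _, K, n, _, ⟨IsManifold.chart_mem_maximalAtlas (I := I) x₀,
        IsManifold.chart_mem_maximalAtlas (I := J) (g₀ x₀), hKc, fun y hy => (hKU hy).1,
        fun y hy => (hKU hy).2, hpos⟩, rfl⟩) ?_)
    refine ⟨fun y hy => (hKU hy).2, fun k _ x _ => ?_⟩
    rw [sub_self, norm_zero]
    exact hpos

/-- If the jets of `g a` converge to those of `g₀` at every point, and the maps `g a` agree with
`g₀` off a fixed compact set, then `g a` converges to `g₀` in the strong topology. -/
theorem tendsto_strongTopology {l : Filter α} {g : α → C^∞⟮I, M; J, N⟯} {g₀ : C^∞⟮I, M; J, N⟯}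
    {K : Set M} (hK : IsCompact K)
    (h : ∀ x₀, JetTendsto I J (l ×ˢ 𝓝 x₀) Prod.snd (fun p => g p.1) x₀ g₀)
    (hoff : ∀ a, ∀ x ∉ K, (g a : M → N) =ᶠ[𝓝 x] g₀) :
    Tendsto g l (@nhds _ (strongTopology I J M N) g₀) := by
  refine tendsto_nhds_generateFrom_iff.2 ?_
  rintro _ ⟨f, ι, φ, ψ, C, r, ε, hC, had, rfl⟩ hg₀
  -- Only finitely many constraints meet `K`; on the others `g a` has the same germs as `g₀`.
  have hfin := hC.finite_nonempty_inter_compact hK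
  have hev : ∀ᶠ a in l, ∀ i ∈ {i | (C i ∩ K).Nonempty},
      g a ∈ derivNhd I J f (φ i) (ψ i) (C i) (r i) (ε i) := by
    rw [Filter.eventually_all_finite hfin]
    exact fun i _ => eventually_mem_derivNhd (had i) (mem_iInter.1 hg₀ i) fun x _ => h x
  filter_upwards [hev] with a ha
  refine mem_iInter.2 fun i => ?_
  by_cases hi : (C i ∩ K).Nonempty
  · exact ha i hi
  · refine mem_derivNhd_of_eventuallyEq (had i).2.2.2.1 (mem_iInter.1 hg₀ i) fun x hx => hoff a x ?_
    exact fun hxK => hi ⟨x, hx, hxK⟩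

end SmoothMaps

/-! ### Jets on open submanifolds -/

section OpenSubmanifold

variable {α : Type*} {EM : Type*} [NormedAddCommGroup EM] [NormedSpace ℝ EM]
  {HM : Type*} [TopologicalSpace HM] {I : ModelWithCorners ℝ EM HM}
  {EN : Type*} [NormedAddCommGroup EN] [NormedSpace ℝ EN]
  {HN : Type*} [TopologicalSpace HN] {J : ModelWithCorners ℝ EN HN}
  {M : Type*} [TopologicalSpace M] [ChartedSpace HM M]
  {N : Type*} [TopologicalSpace N] [ChartedSpace HN N]
  [I.Boundaryless] [IsManifold I ∞ M] [IsManifold J ∞ N]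
  {U : Opens M} {l : Filter α} {f : α → M → N} {f₀ : M → N} {x₀ : U}

theorem JetTendsto.comp_subtypeVal
    (h : JetTendsto I J (l ×ˢ 𝓝 (x₀ : M)) Prod.snd (fun p => f p.1) x₀ f₀) :
    JetTendsto I J (l ×ˢ 𝓝 x₀) Prod.snd (fun p => f p.1 ∘ ((↑) : U → M)) x₀
      (f₀ ∘ ((↑) : U → M)) := by
  have hg : Tendsto (Prod.map id ((↑) : U → M)) (l ×ˢ 𝓝 x₀) (l ×ˢ 𝓝 (x₀ : M)) :=
    tendsto_id.prodMap continuous_subtype_val.continuousAt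
  exact JetTendsto.comp_right (h := ((↑) : U → M)) (x := Prod.snd) (u := fun p : α × U => f p.1)
    (h.comp_filter hg) (Eventually.of_forall fun y => contMDiff_subtype_val.contMDiffAt) tendsto_snd

theorem JetTendsto.of_comp_subtypeVal {S : Set M}
    (h : JetTendsto I J (l ×ˢ 𝓝[(↑) ⁻¹' S] x₀) Prod.snd (fun p => f p.1 ∘ ((↑) : U → M)) x₀
      (f₀ ∘ ((↑) : U → M))) :
    JetTendsto I J (l ×ˢ 𝓝[S] (x₀ : M)) Prod.snd (fun p => f p.1) x₀ f₀ := by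
  classical
  -- A left inverse of the inclusion, smooth on `U`; the value `x₀` off `U` is arbitrary and
  -- invisible to germs at points of `U`.
  let j : M → U := fun y => if hy : y ∈ U then ⟨y, hy⟩ else x₀
  have hj : ∀ y ∈ U, (j y : M) = y := fun y hy => by simp [j, hy]
  have hjU : ∀ y : U, j y = y := fun y => Subtype.ext (hj y y.2)
  have hUn : ∀ y : M, y ∈ U → ∀ᶠ z in 𝓝 y, z ∈ U := fun y hy => U.isOpen.mem_nhds hy
  have hjs : ∀ y ∈ U, ContMDiffAt I I ∞ j y := by
    intro y hy
    refine (contMDiffAt_subtype_iff (x := (⟨y, hy⟩ : U))).1 ?_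
    simp only [hjU]
    exact contMDiffAt_id
  have hsnd : Tendsto (Prod.snd : α × M → M) (l ×ˢ 𝓝[S] (x₀ : M)) (𝓝 (x₀ : M)) :=
    tendsto_snd.mono_right nhdsWithin_le_nhds
  have hjt : Tendsto j (𝓝[S] (x₀ : M)) (𝓝[(↑) ⁻¹' S] x₀) := by
    refine tendsto_nhdsWithin_iff.2 ⟨?_, ?_⟩
    · have := (hjs x₀ x₀.2).continuousAt.tendsto
      rw [hjU] at this
      exact this.mono_left nhdsWithin_le_nhds
    · filter_upwards [self_mem_nhdsWithin, nhdsWithin_le_nhds (hUn _ x₀.2)] with y h1 h2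
      rw [mem_preimage, hj y h2]
      exact h1
  have h1 : JetTendsto I J (l ×ˢ 𝓝[S] (x₀ : M)) (fun p : α × M => j p.2)
      (fun p => f p.1 ∘ ((↑) : U → M)) (j x₀) (f₀ ∘ ((↑) : U → M)) := by
    rw [hjU]
    exact h.comp_filter (tendsto_id.prodMap hjt)
  refine ((h1.comp_right (x := Prod.snd) (x₀ := (x₀ : M)) ?_ hsnd).congr ?_).congr_limit ?_
  · filter_upwards [hUn _ x₀.2] with y hy using hjs y hy
  · filter_upwards [hsnd.eventually (hUn _ x₀.2)] with p hp
    filter_upwards [hUn _ hp] with y hy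
    simp only [Function.comp_apply, hj y hy]
  · filter_upwards [hUn _ x₀.2] with y hy
    simp only [Function.comp_apply, hj y hy]

end OpenSubmanifold

/-! ### Blending sections by bump functions -/

namespace SmoothSections

section Blend

variable {M F : Type*} {V : M → Type*}

variable (F) in
/-- A dependent function, viewed as a map into the total space. -/
def toTotal (s : ∀ x, V x) : M → TotalSpace F V := fun x => ⟨x, s x⟩

variable [∀ x, AddCommGroup (V x)] [∀ x, Module ℝ (V x)]

/-- The dependent function `s + ρ • (t - s)`. -/
def blend (ρ : M → ℝ) (s t : ∀ x, V x) (x : M) : V x := s x + ρ x • (t x - s x)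

variable (F) in
/-- The fibrewise map `p ↦ s + ρ • (p - s)` of the total space. -/
def blendMap (ρ : M → ℝ) (s : ∀ x, V x) (p : TotalSpace F V) : TotalSpace F V :=
  ⟨p.proj, s p.proj + ρ p.proj • (p.2 - s p.proj)⟩

theorem blendMap_comp_toTotal (ρ : M → ℝ) (s t : ∀ x, V x) :
    blendMap F ρ s ∘ toTotal F t = toTotal F (blend ρ s t) := rfl

theorem blend_self (ρ : M → ℝ) (s : ∀ x, V x) : blend ρ s s = s := by
  funext x
  simp [blend]

theorem blend_of_eq_zero {ρ : M → ℝ} {s t : ∀ x, V x} {x : M} (h : ρ x = 0) :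
    blend ρ s t x = s x := by
  simp [blend, h]

theorem blend_of_eq_one {ρ : M → ℝ} {s t : ∀ x, V x} {x : M} (h : ρ x = 1) :
    blend ρ s t x = t x := by
  simp [blend, h]

theorem toTotal_blend_eventuallyEq [TopologicalSpace M] {ρ : M → ℝ} {s t : ∀ x, V x} {x : M} (hx : x ∉ tsupport ρ) :
    toTotal F (blend ρ s t) =ᶠ[𝓝 x] toTotal F s := by
  filter_upwards [(isClosed_tsupport ρ).isOpen_compl.mem_nhds hx] with y hy
  rw [toTotal, toTotal, blend_of_eq_zero (image_eq_zero_of_notMem_tsupport hy)]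

end Blend

variable {α : Type*} {EM : Type*} [NormedAddCommGroup EM] [NormedSpace ℝ EM]
  {HM : Type*} [TopologicalSpace HM] {I : ModelWithCorners ℝ EM HM}
  {M : Type u} [TopologicalSpace M] [ChartedSpace HM M]
  {F : Type*} [NormedAddCommGroup F] [NormedSpace ℝ F]
  {V : M → Type*} [TopologicalSpace (TotalSpace F V)] [∀ x, TopologicalSpace (V x)]
  [FiberBundle F V]

namespace LocalSection

/-- The section over `U` given by a dependent function which is smooth on `U`. -/
def ofFun (U : Opens M) (s : ∀ x, V x)
    (hs : ∀ x ∈ U, ContMDiffAt I (I.prod 𝓘(ℝ, F)) ∞ (toTotal F s) x) : LocalSection I F V U :=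
  ⟨⟨fun x => toTotal F s x, fun x => contMDiffAt_subtype_iff.2 (hs x x.2)⟩, fun _ => rfl⟩

theorem ofFun_congr {U : Opens M} {s t : ∀ x, V x}
    (hs : ∀ x ∈ U, ContMDiffAt I (I.prod 𝓘(ℝ, F)) ∞ (toTotal F s) x)
    (ht : ∀ x ∈ U, ContMDiffAt I (I.prod 𝓘(ℝ, F)) ∞ (toTotal F t) x)
    (h : ∀ x ∈ U, s x = t x) : ofFun U s hs = ofFun U t ht := by
  refine Subtype.ext (ContMDiffMap.ext fun x => ?_)
  change toTotal F s x = toTotal F t x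
  rw [toTotal, toTotal, h x x.2]

variable [∀ x, AddCommGroup (V x)]

open Classical in
/-- The extension by zero of a section over `U`. -/
def extendZero {U : Opens M} (σ : LocalSection I F V U) (x : M) : V x :=
  if h : x ∈ U then (show (σ.1 ⟨x, h⟩).proj = x from σ.2 ⟨x, h⟩) ▸ (σ.1 ⟨x, h⟩).2 else 0

theorem toTotal_extendZero {U : Opens M} (σ : LocalSection I F V U) (x : U) :
    toTotal F σ.extendZero x = σ.1 x := by
  have key : ∀ (p : TotalSpace F V) (y : M) (h : p.proj = y),
      (⟨y, h ▸ p.2⟩ : TotalSpace F V) = p := by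
    rintro p _ rfl
    rfl
  rw [toTotal, extendZero, dif_pos x.2]
  exact key _ _ _

theorem toTotal_extendZero_comp {U : Opens M} (σ : LocalSection I F V U) :
    toTotal F σ.extendZero ∘ ((↑) : U → M) = σ.1 :=
  funext fun x => toTotal_extendZero σ x

theorem contMDiffAt_extendZero {U : Opens M} (σ : LocalSection I F V U) {x : M} (hx : x ∈ U) :
    ContMDiffAt I (I.prod 𝓘(ℝ, F)) ∞ (toTotal F σ.extendZero) x := by
  refine (contMDiffAt_subtype_iff (x := (⟨x, hx⟩ : U))).1 ?_
  simp only [toTotal_extendZero]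
  exact σ.1.contMDiff.contMDiffAt

theorem restrict_eq_ofFun {U W : Opens M} (h : W ≤ U) (σ : LocalSection I F V U) :
    σ.restrict h = ofFun W σ.extendZero fun _ hx => σ.contMDiffAt_extendZero (h hx) := by
  refine Subtype.ext (ContMDiffMap.ext fun x => ?_)
  exact (toTotal_extendZero σ (Opens.inclusion h x)).symm

theorem ofFun_extendZero {U : Opens M} (σ : LocalSection I F V U) :
    ofFun U σ.extendZero (fun _ hx => σ.contMDiffAt_extendZero hx) = σ := by
  refine Subtype.ext (ContMDiffMap.ext fun x => ?_)
  exact toTotal_extendZero σ x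

theorem extendZero_ofFun {U : Opens M} {s : ∀ x, V x}
    (hs : ∀ x ∈ U, ContMDiffAt I (I.prod 𝓘(ℝ, F)) ∞ (toTotal F s) x) {x : M} (hx : x ∈ U) :
    (ofFun U s hs).extendZero x = s x := by
  have := toTotal_extendZero (ofFun U s hs) ⟨x, hx⟩
  simpa [ofFun, toTotal] using this

end LocalSection

variable [∀ x, AddCommGroup (V x)] [∀ x, Module ℝ (V x)]

variable [VectorBundle ℝ F V]

/-- A trivialization is linear on fibres, so it turns the blend into the same formula in the model
fibre `F`. -/
theorem contMDiffAt_blendMap {ρ : M → ℝ} {s : ∀ x, V x} {p : TotalSpace F V}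
    (hρ : ContMDiffAt I 𝓘(ℝ, ℝ) ∞ ρ p.proj)
    (hs : ContMDiffAt I (I.prod 𝓘(ℝ, F)) ∞ (toTotal F s) p.proj) :
    ContMDiffAt (I.prod 𝓘(ℝ, F)) (I.prod 𝓘(ℝ, F)) ∞ (blendMap F ρ s) p := by
  have hproj : ContMDiffAt (I.prod 𝓘(ℝ, F)) I ∞ (TotalSpace.proj : TotalSpace F V → M) p :=
    (Bundle.contMDiffAt_totalSpace.1 contMDiffAt_id).1
  have hid := (Bundle.contMDiffAt_totalSpace.1
    (contMDiffAt_id (I := I.prod 𝓘(ℝ, F)) (n := ∞) (x := p))).2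
  have hs2 := (Bundle.contMDiffAt_totalSpace.1 hs).2
  refine Bundle.contMDiffAt_totalSpace.2 ⟨hproj, ?_⟩
  change ContMDiffAt (I.prod 𝓘(ℝ, F)) 𝓘(ℝ, F) ∞
    (fun q => (trivializationAt F V p.proj (blendMap F ρ s q)).2) p
  set e := trivializationAt F V p.proj
  have hs3 : ContMDiffAt (I.prod 𝓘(ℝ, F)) 𝓘(ℝ, F) ∞
      (fun q : TotalSpace F V => (e (toTotal F s q.proj)).2) p :=
    ContMDiffAt.comp (I' := I) (f := TotalSpace.proj) (g := fun x => (e (toTotal F s x)).2) p hs2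
      hproj
  have hρ3 : ContMDiffAt (I.prod 𝓘(ℝ, F)) 𝓘(ℝ, ℝ) ∞ (fun q : TotalSpace F V => ρ q.proj) p :=
    ContMDiffAt.comp (I' := I) p hρ hproj
  have hmain : ContMDiffAt (I.prod 𝓘(ℝ, F)) 𝓘(ℝ, F) ∞ (fun q : TotalSpace F V =>
      (e (toTotal F s q.proj)).2 + ρ q.proj • ((e q).2 - (e (toTotal F s q.proj)).2)) p :=
    hs3.add (hρ3.smul (hid.sub hs3))
  refine hmain.congr_of_eventuallyEq ?_
  have hb : ∀ᶠ q : TotalSpace F V in 𝓝 p, q.proj ∈ e.baseSet :=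
    hproj.continuousAt.eventually (e.open_baseSet.mem_nhds (mem_baseSet_trivializationAt F V p.proj))
  filter_upwards [hb] with q hq
  have hlin := e.linear ℝ hq
  have h1 := hlin.map_add (s q.proj) (ρ q.proj • (q.2 - s q.proj))
  have h2 := hlin.map_smul (ρ q.proj) (q.2 - s q.proj)
  have h3 := hlin.map_sub q.2 (s q.proj)
  simp only [blendMap, toTotal] at *
  rw [h1, h2, h3]

theorem contMDiffAt_blend {ρ : M → ℝ} {s t : ∀ x, V x} {x : M} (hρ : ContMDiff I 𝓘(ℝ, ℝ) ∞ ρ)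
    (hs : ContMDiffAt I (I.prod 𝓘(ℝ, F)) ∞ (toTotal F s) x)
    (ht : x ∈ tsupport ρ → ContMDiffAt I (I.prod 𝓘(ℝ, F)) ∞ (toTotal F t) x) :
    ContMDiffAt I (I.prod 𝓘(ℝ, F)) ∞ (toTotal F (blend ρ s t)) x := by
  by_cases hx : x ∈ tsupport ρ
  · rw [← blendMap_comp_toTotal]
    exact (contMDiffAt_blendMap (p := toTotal F t x) hρ.contMDiffAt hs).comp x (ht hx)
  · exact hs.congr_of_eventuallyEq (toTotal_blend_eventuallyEq hx)

variable [I.Boundaryless] [IsManifold I ∞ M] [ContMDiffVectorBundle ∞ F V I]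

/-- On the support, the blend is the fixed smooth map `blendMap F ρ s` applied to `t`, and this map
fixes `s`. Off the support the blend has the germ of `s`. Hence jets of `t` are needed only at
points of the support. -/
theorem jetTendsto_blend {l : Filter α} {ρ : M → ℝ} {s : ∀ x, V x} {t : α → ∀ x, V x} {x₀ : M}
    (hρ : ContMDiff I 𝓘(ℝ, ℝ) ∞ ρ)
    (hs : ∀ x, ContMDiffAt I (I.prod 𝓘(ℝ, F)) ∞ (toTotal F s) x)
    (ht : x₀ ∈ tsupport ρ → JetTendsto I (I.prod 𝓘(ℝ, F)) (l ×ˢ 𝓝[tsupport ρ] x₀) Prod.snd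
      (fun p => toTotal F (t p.1)) x₀ (toTotal F s)) :
    JetTendsto I (I.prod 𝓘(ℝ, F)) (l ×ˢ 𝓝 x₀) Prod.snd
      (fun p => toTotal F (blend ρ s (t p.1))) x₀ (toTotal F s) := by
  have hconst : JetTendsto I (I.prod 𝓘(ℝ, F)) (l ×ˢ 𝓝 x₀) Prod.snd
      (fun _ => toTotal F s) x₀ (toTotal F s) :=
    JetTendsto.of_const (Eventually.of_forall hs) tendsto_snd
  have hsplit : l ×ˢ 𝓝 x₀ = l ×ˢ 𝓝[tsupport ρ] x₀ ⊔ l ×ˢ 𝓝[(tsupport ρ)ᶜ] x₀ := by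
    rw [← Filter.prod_sup, ← nhdsWithin_union, union_compl_self, nhdsWithin_univ]
  rw [hsplit]
  refine JetTendsto.sup ?_ ?_
  · by_cases hx : x₀ ∈ tsupport ρ
    · have h1 := (ht hx).comp_left (h := blendMap F ρ s)
        (Eventually.of_forall fun p => contMDiffAt_blendMap hρ.contMDiffAt (hs p.proj))
      simpa only [blendMap_comp_toTotal, blend_self] using h1
    · have hbot : 𝓝[tsupport ρ] x₀ = ⊥ := by
        rw [← not_neBot, ← mem_closure_iff_nhdsWithin_neBot, (isClosed_tsupport ρ).closure_eq]
        exact hx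
      rw [hbot, Filter.prod_bot]
      exact (hconst.mono bot_le).congr (by simp)
  · refine (hconst.mono (Filter.prod_mono le_rfl nhdsWithin_le_nhds)).congr ?_
    have : ∀ᶠ p : α × M in l ×ˢ 𝓝[(tsupport ρ)ᶜ] x₀, p.2 ∈ (tsupport ρ)ᶜ :=
      tendsto_snd.eventually self_mem_nhdsWithin
    filter_upwards [this] with p hp using toTotal_blend_eventuallyEq hp

/-- Blending a smooth section `s` with sections whose jets converge to those of `s` on the compact
support of `ρ` gives sections converging strongly to `s`. -/
theorem tendsto_strongTopology_blend {l : Filter α} {ρ : M → ℝ} {s : ∀ x, V x}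
    {t : α → ∀ x, V x} {A : Opens M} (hρ : ContMDiff I 𝓘(ℝ, ℝ) ∞ ρ)
    (hs : ∀ x, ContMDiffAt I (I.prod 𝓘(ℝ, F)) ∞ (toTotal F s) x)
    (hcpt : HasCompactSupport ρ) (hA : tsupport ρ ⊆ A)
    (hb : ∀ a, ∀ x ∈ A, ContMDiffAt I (I.prod 𝓘(ℝ, F)) ∞ (toTotal F (blend ρ s (t a))) x)
    (ht : ∀ x₀ ∈ tsupport ρ, JetTendsto I (I.prod 𝓘(ℝ, F)) (l ×ˢ 𝓝[tsupport ρ] x₀) Prod.snd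
      (fun p => toTotal F (t p.1)) x₀ (toTotal F s)) :
    Tendsto (fun a => LocalSection.ofFun A (blend ρ s (t a)) (hb a)) l
      (@nhds _ (strongTopology I F V A) (LocalSection.ofFun A s fun x _ => hs x)) := by
  have : IsManifold (I.prod 𝓘(ℝ, F)) ∞ (TotalSpace F V) := Bundle.TotalSpace.isManifold F V
  rw [@nhds_induced _ _ (SmoothMaps.strongTopology I (I.prod 𝓘(ℝ, F)) A (TotalSpace F V)),
    tendsto_comap_iff]
  have hK : IsCompact (((↑) : A → M) ⁻¹' tsupport ρ) := by
    rw [Subtype.isCompact_iff, image_preimage_eq_of_subset (by simpa using hA)]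
    exact hcpt
  refine SmoothMaps.tendsto_strongTopology hK (fun x₀ => ?_) (fun a x hx => ?_)
  · exact JetTendsto.comp_subtypeVal (f := fun a => toTotal F (blend ρ s (t a)))
      (jetTendsto_blend hρ hs (ht x₀))
  · exact (toTotal_blend_eventuallyEq (F := F) (s := s) (t := t a) hx).comp_tendsto
      continuous_subtype_val.continuousAt

end SmoothSections

/-! ### Local perturbation and strong openness -/

theorem SmoothMaps.derivNhd_subset {EM : Type*} [NormedAddCommGroup EM] [NormedSpace ℝ EM]
    {HM : Type*} [TopologicalSpace HM] {I : ModelWithCorners ℝ EM HM}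
    {EN : Type*} [NormedAddCommGroup EN] [NormedSpace ℝ EN]
    {HN : Type*} [TopologicalSpace HN] {J : ModelWithCorners ℝ EN HN}
    {M N : Type*} [TopologicalSpace M] [ChartedSpace HM M] [TopologicalSpace N]
    [ChartedSpace HN N] {f : C^∞⟮I, M; J, N⟯} {φ : OpenPartialHomeomorph M HM}
    {ψ : OpenPartialHomeomorph N HN} {K : Set M} {r r' : ℕ} {ε ε' : ℝ} (hr : r ≤ r')
    (hε : ε' ≤ ε) : derivNhd I J f φ ψ K r' ε' ⊆ derivNhd I J f φ ψ K r ε :=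
  fun _ hg => ⟨hg.1, fun k hk x hx => (hg.2 k (hk.trans hr) x hx).trans_le hε⟩

theorem SmoothMaps.self_mem_derivNhd {EM : Type*} [NormedAddCommGroup EM] [NormedSpace ℝ EM]
    {HM : Type*} [TopologicalSpace HM] {I : ModelWithCorners ℝ EM HM}
    {EN : Type*} [NormedAddCommGroup EN] [NormedSpace ℝ EN]
    {HN : Type*} [TopologicalSpace HN] {J : ModelWithCorners ℝ EN HN}
    {M N : Type*} [TopologicalSpace M] [ChartedSpace HM M] [TopologicalSpace N]
    [ChartedSpace HN N] {f : C^∞⟮I, M; J, N⟯} {φ : OpenPartialHomeomorph M HM}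
    {ψ : OpenPartialHomeomorph N HN} {K : Set M} {ε : ℝ} (hf : MapsTo f K ψ.source) (hε : 0 < ε)
    (r : ℕ) : f ∈ derivNhd I J f φ ψ K r ε :=
  ⟨hf, fun k _ x _ => by rwa [sub_self, norm_zero]⟩

theorem LocallyFinite.biUnion_encode {X ι : Type*} [TopologicalSpace X] [Encodable ι]
    {T : ι → Set X} (hT : LocallyFinite T) :
    LocallyFinite fun k : ℕ => ⋃ (i : ι) (_ : Encodable.encode i = k), T i := by
  intro x
  obtain ⟨t, ht, hfin⟩ := hT x
  refine ⟨t, ht, (hfin.image Encodable.encode).subset ?_⟩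
  rintro k ⟨y, hy, hyt⟩
  simp only [mem_iUnion] at hy
  obtain ⟨i, hi, hy⟩ := hy
  exact ⟨i, ⟨y, hy, hyt⟩, hi⟩

namespace SmoothSections

variable {α : Type*} {EM : Type*} [NormedAddCommGroup EM] [NormedSpace ℝ EM]
  {HM : Type*} [TopologicalSpace HM] {I : ModelWithCorners ℝ EM HM}
  {M : Type u} [TopologicalSpace M] [ChartedSpace HM M]
  {F : Type*} [NormedAddCommGroup F] [NormedSpace ℝ F]
  {V : M → Type*} [TopologicalSpace (TotalSpace F V)] [∀ x, TopologicalSpace (V x)]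
  [FiberBundle F V]

theorem strongTopology_le_weakTopology (U : Opens M) :
    strongTopology I F V U ≤ weakTopology I F V U :=
  induced_mono SmoothMaps.strongTopology_le_weakTopology

variable [I.Boundaryless] [IsManifold I ∞ M] [∀ x, AddCommGroup (V x)] [∀ x, Module ℝ (V x)]
  [VectorBundle ℝ F V] [ContMDiffVectorBundle ∞ F V I]
  {X : ∀ U : Opens M, Set (LocalSection I F V U)}

/-- If `X U` is strongly open and contains the restriction of `σ`, then sections whose jets
converge to those of `σ` on a compact subset of `U` eventually restrict to elements of `X W`, for
`W` an open set on which a bump function supported in that compact set equals `1`. -/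
theorem eventually_restrict_mem (hX : IsSmoothClass X) {U W : Opens M} (hWU : W ≤ U)
    (hU : StronglyOpen (X U)) {ρ : M → ℝ} (hρ : ContMDiff I 𝓘(ℝ, ℝ) ∞ ρ)
    (hcpt : HasCompactSupport ρ) (hsupp : tsupport ρ ⊆ U) (hW : ∀ x ∈ W, ρ x = 1)
    {σ : LocalSection I F V (⊤ : Opens M)} (hσ : σ.restrict (le_top : U ≤ ⊤) ∈ X U)
    {l : Filter α} {τ : α → LocalSection I F V (⊤ : Opens M)}
    (hτ : ∀ x₀ ∈ tsupport ρ, JetTendsto I (I.prod 𝓘(ℝ, F)) (l ×ˢ 𝓝[tsupport ρ] x₀) Prod.snd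
      (fun p => toTotal F (τ p.1).extendZero) x₀ (toTotal F σ.extendZero)) :
    ∀ᶠ a in l, (τ a).restrict (le_top : W ≤ ⊤) ∈ X W := by
  have hs : ∀ (t : LocalSection I F V (⊤ : Opens M)) x,
      ContMDiffAt I (I.prod 𝓘(ℝ, F)) ∞ (toTotal F t.extendZero) x :=
    fun t x => t.contMDiffAt_extendZero (Opens.mem_top x)
  have hb : ∀ a x, ContMDiffAt I (I.prod 𝓘(ℝ, F)) ∞
      (toTotal F (blend ρ σ.extendZero (τ a).extendZero)) x :=
    fun a x => contMDiffAt_blend hρ (hs σ x) fun _ => hs _ x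
  -- The restrictions of `τ a` to `U` need not converge strongly, but their blends with `σ` do, and
  -- these equal `τ a` on `W`.
  have h1 := tendsto_strongTopology_blend hρ (hs σ) hcpt hsupp (fun a x _ => hb a x) hτ
  rw [LocalSection.restrict_eq_ofFun] at hσ
  filter_upwards [h1 (@IsOpen.mem_nhds _ (strongTopology I F V U) _ _ hU hσ)] with a ha
  have h2 := hX.restrict_mem U W hWU _ ha
  rw [LocalSection.restrict_eq_ofFun] at h2 ⊢
  convert h2 using 1
  refine LocalSection.ofFun_congr _ _ fun x hx => ?_
  rw [LocalSection.extendZero_ofFun _ (hWU hx), blend_of_eq_one (hW x hx)]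

variable [FiniteDimensional ℝ EM]

theorem jetTendsto_extendZero {U : Opens M} {l : Filter α} {τ : α → LocalSection I F V U}
    {σ : LocalSection I F V U} (h : Tendsto τ l (@nhds _ (weakTopology I F V U) σ))
    {x₀ : M} (hx₀ : x₀ ∈ U) :
    JetTendsto I (I.prod 𝓘(ℝ, F)) (l ×ˢ 𝓝 x₀) Prod.snd (fun p => toTotal F (τ p.1).extendZero)
      x₀ (toTotal F σ.extendZero) := by
  have : IsManifold (I.prod 𝓘(ℝ, F)) ∞ (TotalSpace F V) := Bundle.TotalSpace.isManifold F V
  have : LocallyCompactSpace M := Manifold.locallyCompact_of_finiteDimensional I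
  have : LocallyCompactSpace U := U.isOpen.locallyCompactSpace
  rw [@nhds_induced _ _ (SmoothMaps.weakTopology I (I.prod 𝓘(ℝ, F)) U (TotalSpace F V)),
    tendsto_comap_iff] at h
  have h1 := SmoothMaps.jetTendsto_of_tendsto_weakTopology h ⟨x₀, hx₀⟩
  have h2 := JetTendsto.of_comp_subtypeVal (I := I) (J := I.prod 𝓘(ℝ, F)) (l := l) (S := univ)
    (f := fun a => toTotal F (τ a).extendZero) (f₀ := toTotal F σ.extendZero)
    (x₀ := (⟨x₀, hx₀⟩ : U)) (by
      simp only [LocalSection.toTotal_extendZero_comp, preimage_univ, nhdsWithin_univ]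
      exact h1)
  rwa [nhdsWithin_univ] at h2

/-- A section can be perturbed inside a strongly open set, on the support of a bump function, so
that all sections strongly close to the perturbed one restrict to elements of `X W'`. -/
theorem exists_perturbation (hX : IsSmoothClass X) {U W W' : Opens M} (hWU : W ≤ U) (hW' : W' ≤ W)
    (hdense : WeaklyDense (X U)) (hW : StronglyOpen (X W)) {ρ ρ' : M → ℝ}
    (hρ : ContMDiff I 𝓘(ℝ, ℝ) ∞ ρ) (hcpt : HasCompactSupport ρ) (hsupp : tsupport ρ ⊆ U)
    (hone : ∀ x ∈ W, ρ x = 1) (hρ' : ContMDiff I 𝓘(ℝ, ℝ) ∞ ρ') (hcpt' : HasCompactSupport ρ')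
    (hsupp' : tsupport ρ' ⊆ W) (hone' : ∀ x ∈ W', ρ' x = 1)
    {σ : LocalSection I F V (⊤ : Opens M)} {O : Set (LocalSection I F V (⊤ : Opens M))}
    (hO : StronglyOpen O) (hσ : σ ∈ O) :
    ∃ (σ' : LocalSection I F V (⊤ : Opens M)) (O' : Set (LocalSection I F V (⊤ : Opens M))),
      StronglyOpen O' ∧ σ' ∈ O' ∧ O' ⊆ O ∧
      (∀ x ∉ tsupport ρ, σ'.extendZero x = σ.extendZero x) ∧
      ∀ τ ∈ O', τ.restrict (le_top : W' ≤ ⊤) ∈ X W' := by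
  have hs : ∀ (t : LocalSection I F V (⊤ : Opens M)) x,
      ContMDiffAt I (I.prod 𝓘(ℝ, F)) ∞ (toTotal F t.extendZero) x :=
    fun t x => t.contMDiffAt_extendZero (Opens.mem_top x)
  have hb : ∀ (τ : LocalSection I F V U) x, ContMDiffAt I (I.prod 𝓘(ℝ, F)) ∞
      (toTotal F (blend ρ σ.extendZero τ.extendZero)) x :=
    fun τ x => contMDiffAt_blend hρ (hs σ x) fun hx => τ.contMDiffAt_extendZero (hsupp hx)
  have h1 := tendsto_strongTopology_blend (A := ⊤) (t := fun τ : LocalSection I F V U =>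
      τ.extendZero) (l := @nhds _ (weakTopology I F V U) (σ.restrict le_top)) hρ (hs σ) hcpt
    (by simp) (fun τ x _ => hb τ x) (fun x₀ hx₀ => by
      have h2 := jetTendsto_extendZero (I := I) (F := F) (τ := id) tendsto_id (hsupp hx₀)
        (σ := σ.restrict (le_top : U ≤ ⊤))
      refine (h2.mono (Filter.prod_mono le_rfl nhdsWithin_le_nhds)).congr_limit ?_
      filter_upwards [U.isOpen.mem_nhds (hsupp hx₀)] with y hy
      rw [LocalSection.restrict_eq_ofFun, toTotal, toTotal, LocalSection.extendZero_ofFun _ hy])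
  rw [LocalSection.ofFun_extendZero] at h1
  -- Blending turns weak closeness over `U` into strong closeness over `M`, so weak density is
  -- enough to remain in `O`.
  obtain ⟨τ, hτX, hτO⟩ := @Dense.inter_nhds_nonempty _ (weakTopology I F V U) _ _ _ hdense
    (h1 (@IsOpen.mem_nhds _ (strongTopology I F V ⊤) _ _ hO hσ))
  set σ' : LocalSection I F V (⊤ : Opens M) :=
    LocalSection.ofFun ⊤ (blend ρ σ.extendZero τ.extendZero) (fun x _ => hb τ x)
  have hext : ∀ x, σ'.extendZero x = blend ρ σ.extendZero τ.extendZero x :=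
    fun x => LocalSection.extendZero_ofFun _ (Opens.mem_top x)
  -- The blend equals `τ` only where `ρ = 1`. Thus membership is known over `W`, not over `U`, and
  -- openness of `X W` is what is used next.
  have hmem : σ'.restrict (le_top : W ≤ ⊤) ∈ X W := by
    have h2 := hX.restrict_mem U W hWU τ hτX
    rw [LocalSection.restrict_eq_ofFun] at h2 ⊢
    convert h2 using 1
    refine LocalSection.ofFun_congr _ _ fun x hx => ?_
    rw [hext, blend_of_eq_one (hone x hx)]
  have h3 := eventually_restrict_mem hX hW' hW hρ' hcpt' hsupp' hone' hmem
    (l := @nhds _ (strongTopology I F V ⊤) σ') (τ := id) (fun x₀ _ =>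
      (jetTendsto_extendZero (I := I) (F := F) (U := ⊤)
        (tendsto_id'.2 (nhds_mono (strongTopology_le_weakTopology ⊤))) (Opens.mem_top x₀)).mono
        (Filter.prod_mono le_rfl nhdsWithin_le_nhds))
  obtain ⟨O', hO'sub, hO'open, hO'mem⟩ :=
    (@eventually_nhds_iff _ (strongTopology I F V ⊤) _ _).1 h3
  refine ⟨σ', O ∩ O', @IsOpen.inter _ (strongTopology I F V ⊤) _ _ hO hO'open, ⟨hτO, hO'mem⟩,
    inter_subset_left, fun x hx => ?_, fun τ hτ => hO'sub τ hτ.2⟩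
  rw [hext, blend_of_eq_zero (image_eq_zero_of_notMem_tsupport hx)]

variable [T2Space M] [SecondCountableTopology M]

theorem IsSmoothClass.stronglyOpen_top (hX : IsSmoothClass X) {𝒰 : Set (Opens M)}
    (h𝒰 : sSup 𝒰 = ⊤) (hopen : ∀ W ∈ 𝒰, StronglyOpen (X W)) :
    StronglyOpen (X ⊤) := by
  have : IsManifold (I.prod 𝓘(ℝ, F)) ∞ (TotalSpace F V) := Bundle.TotalSpace.isManifold F V
  have : LocallyCompactSpace M := Manifold.locallyCompact_of_finiteDimensional I
  refine (@isOpen_iff_forall_mem_open _ (strongTopology I F V ⊤) _).2 fun σ hσ => ?_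
  have hcov : ∀ x : M, ∃ W ∈ 𝒰, x ∈ W := fun x => by
    have : x ∈ sSup 𝒰 := h𝒰 ▸ Opens.mem_top x
    simpa [Opens.mem_sSup] using this
  choose W hW𝒰 hxW using hcov
  let j : M → (⊤ : Opens M) := fun x => ⟨x, Opens.mem_top x⟩
  have hj : Continuous j := continuous_id.subtype_mk _
  let φ : M → OpenPartialHomeomorph (⊤ : Opens M) HM := fun x => chartAt HM (j x)
  let ψ : M → OpenPartialHomeomorph (TotalSpace F V) (ModelProd HM F) :=
    fun x => chartAt (ModelProd HM F) (σ.1 (j x))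
  have hN : ∀ x ∈ (univ : Set M),
      (W x : Set M) ∩ j ⁻¹' ((φ x).source ∩ σ.1 ⁻¹' (ψ x).source) ∈ 𝓝 x := by
    intro x _
    refine inter_mem ((W x).isOpen.mem_nhds (hxW x)) (hj.continuousAt (inter_mem ?_ ?_))
    · exact (φ x).open_source.mem_nhds (mem_chart_source _ _)
    · exact σ.1.contMDiff.continuous.continuousAt
        ((ψ x).open_source.mem_nhds (mem_chart_source _ _))
  obtain ⟨ι, fs, hfs⟩ := SmoothBumpCovering.exists_isSubordinate I isClosed_univ hN
  let K : ι → Set (⊤ : Opens M) := fun i => (↑) ⁻¹' tsupport (fs i)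
  have hKc : ∀ i, IsCompact (K i) := fun i => by
    rw [Subtype.isCompact_iff, image_preimage_eq_of_subset (by simp)]
    exact (fs i).hasCompactSupport
  have hKφ : ∀ i, K i ⊆ (φ (fs.c i)).source := fun i x hx => (hfs i hx).2.1
  have hKψ : ∀ i, MapsTo σ.1 (K i) (ψ (fs.c i)).source := fun i x hx => (hfs i hx).2.2
  have hlf : LocallyFinite K :=
    fs.locallyFinite.closure.preimage_continuous continuous_subtype_val
  have hφ : ∀ x, φ x ∈ IsManifold.maximalAtlas I ∞ (⊤ : Opens M) :=
    fun x => IsManifold.chart_mem_maximalAtlas _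
  have hψ : ∀ x, ψ x ∈ IsManifold.maximalAtlas (I.prod 𝓘(ℝ, F)) ∞ (TotalSpace F V) :=
    fun x => IsManifold.chart_mem_maximalAtlas _
  let W' : ι → Opens M := fun i => ⟨interior {x | fs i x = 1}, isOpen_interior⟩
  have hone : ∀ i, ∀ x ∈ W' i, fs i x = 1 :=
    fun i x hx => (interior_subset hx : x ∈ {x | fs i x = 1})
  have hW' : ∀ i, W' i ≤ W (fs.c i) := fun i x hx =>
    (hfs i (subset_tsupport _ (by rw [Function.mem_support, hone i x hx]; exact one_ne_zero))).1
  have hstab : ∀ i, ∃ n : ℕ, ∀ τ : LocalSection I F V (⊤ : Opens M),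
      τ.1 ∈ SmoothMaps.derivNhd I (I.prod 𝓘(ℝ, F)) σ.1 (φ (fs.c i)) (ψ (fs.c i)) (K i) n
        (1 / ((n : ℝ) + 1)) → τ.restrict (le_top : W' i ≤ ⊤) ∈ X (W' i) := by
    intro i
    -- If no `n` worked, the counterexamples would form a sequence whose jets converge to those of
    -- `σ` on the support, contradicting `eventually_restrict_mem`.
    by_contra! hcon
    choose τ hτ hτX using hcon
    have hjet : ∀ x₀ ∈ tsupport (fs i), JetTendsto I (I.prod 𝓘(ℝ, F))
        (atTop ×ˢ 𝓝[tsupport (fs i)] x₀) Prod.snd (fun p => toTotal F (τ p.1).extendZero) x₀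
        (toTotal F σ.extendZero) := by
      intro x₀ hx₀
      refine JetTendsto.of_comp_subtypeVal (f := fun n => toTotal F (τ n).extendZero)
        (x₀ := j x₀) ?_
      simp only [LocalSection.toTotal_extendZero_comp]
      refine SmoothMaps.jetTendsto_of_eventually_mem_derivNhd (g := fun n => (τ n).1)
        (hφ (fs.c i)) (hψ (fs.c i)) (hKφ i) (hKψ i) (fun n => ?_) hx₀
      filter_upwards [eventually_ge_atTop n] with m hm
      refine SmoothMaps.derivNhd_subset hm (one_div_le_one_div_of_le (by positivity) ?_) (hτ m)
      have : (n : ℝ) ≤ m := by exact_mod_cast hm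
      linarith
    obtain ⟨n, hn⟩ := (eventually_restrict_mem hX (hW' i) (hopen _ (hW𝒰 _)) (fs i).contMDiff
      (fs i).hasCompactSupport (fun x hx => (hfs i hx).1) (hone i)
      (hX.restrict_mem _ _ le_top σ hσ) hjet).exists
    exact hτX n hn
  choose n hn using hstab
  have hpos : ∀ i, (0 : ℝ) < 1 / ((n i : ℝ) + 1) := fun i => by positivity
  refine ⟨Subtype.val ⁻¹' ⋂ i, SmoothMaps.derivNhd I (I.prod 𝓘(ℝ, F)) σ.1 (φ (fs.c i))
    (ψ (fs.c i)) (K i) (n i) (1 / ((n i : ℝ) + 1)), fun τ hτ => ?_, ?_, ?_⟩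
  · refine hX.mem_of_cover τ (range W') (eq_top_iff.2 fun x _ => ?_) ?_
    · obtain ⟨i, hi⟩ := fs.eventuallyEq_one' x (mem_univ x)
      exact Opens.mem_sSup.2 ⟨W' i, mem_range_self i, mem_interior_iff_mem_nhds.2 hi⟩
    · rintro _ ⟨i, rfl⟩
      exact hn i τ (mem_iInter.1 hτ i)
  · exact (@isOpen_induced _ _ (SmoothMaps.strongTopology I (I.prod 𝓘(ℝ, F)) (⊤ : Opens M)
      (TotalSpace F V)) _ _ (isOpen_generateFrom_of_mem ⟨σ.1, ι, fun i => φ (fs.c i),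
        fun i => ψ (fs.c i), K, n, fun i => 1 / ((n i : ℝ) + 1), hlf,
        fun i => ⟨hφ _, hψ _, hKc i, hKφ i, hKψ i, hpos i⟩, rfl⟩))
  · exact mem_iInter.2 fun i => SmoothMaps.self_mem_derivNhd (hKψ i) (hpos i) (n i)

end SmoothSections

/-! ### Strong density by successive corrections -/

theorem Real.smoothTransition.contMDiff_affine_comp {EM : Type*} [NormedAddCommGroup EM]
    [NormedSpace ℝ EM] {HM : Type*} [TopologicalSpace HM] {I : ModelWithCorners ℝ EM HM}
    {M : Type*} [TopologicalSpace M] [ChartedSpace HM M] {ρ : M → ℝ}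
    (hρ : ContMDiff I 𝓘(ℝ, ℝ) ∞ ρ) (a b : ℝ) :
    ContMDiff I 𝓘(ℝ, ℝ) ∞ fun x => Real.smoothTransition (a * ρ x - b) := by
  have : ContDiff ℝ ∞ fun t : ℝ => Real.smoothTransition (a * t - b) :=
    Real.smoothTransition.contDiff.comp ((contDiff_const.mul contDiff_id).sub contDiff_const)
  exact this.contMDiff.comp hρ

theorem Real.smoothTransition.tsupport_affine_comp_subset {X : Type*} [TopologicalSpace X]
    {ρ : X → ℝ} (hρ : Continuous ρ) {a b : ℝ} (ha : 0 < a) :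
    tsupport (fun x => Real.smoothTransition (a * ρ x - b)) ⊆ {x | b / a ≤ ρ x} := by
  refine closure_minimal (fun x hx => ?_) (isClosed_le continuous_const hρ)
  by_contra hlt
  refine hx (Real.smoothTransition.zero_of_nonpos ?_)
  have : ρ x < b / a := not_le.1 hlt
  rw [lt_div_iff₀ ha] at this
  linarith

namespace SmoothSections

variable {EM : Type*} [NormedAddCommGroup EM] [NormedSpace ℝ EM]
  [FiniteDimensional ℝ EM] {HM : Type*} [TopologicalSpace HM] {I : ModelWithCorners ℝ EM HM}
  [I.Boundaryless] {M : Type u} [TopologicalSpace M] [ChartedSpace HM M] [IsManifold I ∞ M]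
  {F : Type*} [NormedAddCommGroup F] [NormedSpace ℝ F]
  {V : M → Type*} [TopologicalSpace (TotalSpace F V)] [∀ x, TopologicalSpace (V x)]
  [∀ x, AddCommGroup (V x)] [∀ x, Module ℝ (V x)]
  [FiberBundle F V] [VectorBundle ℝ F V] [ContMDiffVectorBundle ∞ F V I]
  [T2Space M] [SecondCountableTopology M]
  {X : ∀ U : Opens M, Set (LocalSection I F V U)}

theorem IsSmoothClass.stronglyDense_top (hX : IsSmoothClass X) {𝒰 : Set (Opens M)}
    (h𝒰 : sSup 𝒰 = ⊤) (hopen : ∀ W ∈ 𝒰, ∀ U ≤ W, StronglyOpen (X U))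
    (hdense : ∀ W ∈ 𝒰, WeaklyDense (X W)) : StronglyDense (X ⊤) := by
  have : LocallyCompactSpace M := Manifold.locallyCompact_of_finiteDimensional I
  have hcov : ∀ x : M, ∃ W ∈ 𝒰, x ∈ W := fun x => by
    have : x ∈ sSup 𝒰 := h𝒰 ▸ Opens.mem_top x
    simpa [Opens.mem_sSup] using this
  choose U hU𝒰 hxU using hcov
  obtain ⟨ι, fs, hfs⟩ := SmoothBumpCovering.exists_isSubordinate I (U := fun x => (U x : Set M))
    isClosed_univ (fun x _ => (U x).isOpen.mem_nhds (hxU x))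
  have : Countable ι := countable_univ_iff.1
    (fs.locallyFinite.countable_univ fun i => (fs i).nonempty_support)
  have : Encodable ι := Encodable.ofCountable ι
  have hfc : ∀ i, Continuous (fs i) := fun i => (fs i).continuous
  let W : ι → Opens M := fun i => ⟨{x | 1 / 2 < fs i x}, isOpen_lt continuous_const (hfc i)⟩
  let W' : ι → Opens M := fun i => ⟨{x | 3 / 4 < fs i x}, isOpen_lt continuous_const (hfc i)⟩
  -- `ρ i` is supported in `{fs i ≥ 1/4}` and is `1` on `W i`; `ρ' i` is supported in `{fs i ≥
  -- 2/3}`, inside `W i`, and is `1` on `W' i`.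
  let ρ : ι → M → ℝ := fun i x => Real.smoothTransition (4 * fs i x - 1)
  let ρ' : ι → M → ℝ := fun i x => Real.smoothTransition (12 * fs i x - 8)
  have hpos_supp : ∀ (i : ι) (x : M), 0 < fs i x → x ∈ tsupport (fs i) :=
    fun i x hx => subset_tsupport _ hx.ne'
  have hρs : ∀ i, tsupport (ρ i) ⊆ tsupport (fs i) := fun i x hx => by
    have h : 1 / 4 ≤ fs i x :=
      Real.smoothTransition.tsupport_affine_comp_subset (hfc i) (by norm_num) hx
    exact hpos_supp i x (by linarith)
  have hρs' : ∀ i, tsupport (ρ' i) ⊆ W i := fun i x hx => by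
    have h : 8 / 12 ≤ fs i x :=
      Real.smoothTransition.tsupport_affine_comp_subset (hfc i) (by norm_num) hx
    change 1 / 2 < fs i x
    linarith
  have hWs : ∀ i, (W i : Set M) ⊆ tsupport (fs i) := fun i x hx => by
    have h : 1 / 2 < fs i x := hx
    exact hpos_supp i x (by linarith)
  have hW'W : ∀ i, W' i ≤ W i := fun i x hx => by
    have h : 3 / 4 < fs i x := hx
    change 1 / 2 < fs i x
    linarith
  have hcs : ∀ i, IsCompact (tsupport (fs i)) := fun i => (fs i).hasCompactSupport
  -- The state is a section with a strong neighbourhood of it. Step `k` treats the index encoded by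
  -- `k`, and changes nothing if there is none.
  have hstep : ∀ (k : ℕ) (p : {p : LocalSection I F V (⊤ : Opens M) ×
      Set (LocalSection I F V (⊤ : Opens M)) // StronglyOpen p.2 ∧ p.1 ∈ p.2}),
      ∃ q : {p : LocalSection I F V (⊤ : Opens M) ×
        Set (LocalSection I F V (⊤ : Opens M)) // StronglyOpen p.2 ∧ p.1 ∈ p.2},
      q.1.2 ⊆ p.1.2 ∧
      {x | q.1.1.extendZero x ≠ p.1.1.extendZero x} ⊆
        ⋃ (i : ι) (_ : Encodable.encode i = k), tsupport (fs i) ∧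
      ∀ i : ι, Encodable.encode i = k → ∀ τ ∈ q.1.2,
        τ.restrict (le_top : W' i ≤ ⊤) ∈ X (W' i) := by
    rintro k ⟨⟨σ, O⟩, hO, hσ⟩
    by_cases hk : ∃ i : ι, Encodable.encode i = k
    · obtain ⟨i, rfl⟩ := hk
      have hWU : W i ≤ U (fs.c i) := fun x hx => hfs i (hWs i hx)
      obtain ⟨σ', O', h1, h2, h3, h4, h5⟩ := exists_perturbation hX (ρ := ρ i) (ρ' := ρ' i)
        hWU (hW'W i) (hdense _ (hU𝒰 _)) (hopen _ (hU𝒰 (fs.c i)) _ hWU)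
        (Real.smoothTransition.contMDiff_affine_comp (fs i).contMDiff 4 1)
        ((hcs i).of_isClosed_subset (isClosed_tsupport _) (hρs i))
        ((hρs i).trans (hfs i))
        (fun x hx => Real.smoothTransition.one_of_one_le (by
          have h : 1 / 2 < fs i x := hx
          linarith))
        (Real.smoothTransition.contMDiff_affine_comp (fs i).contMDiff 12 8)
        ((hcs i).of_isClosed_subset (isClosed_tsupport _) ((hρs' i).trans (hWs i)))
        (hρs' i)
        (fun x hx => Real.smoothTransition.one_of_one_le (by
          have h : 3 / 4 < fs i x := hx
          linarith))
        hO hσ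
      refine ⟨⟨⟨σ', O'⟩, h1, h2⟩, h3, fun x hx => ?_, fun i' hi' => ?_⟩
      · refine mem_iUnion₂.2 ⟨i, rfl, hρs i ?_⟩
        by_contra hxs
        exact hx (h4 x hxs)
      · obtain rfl := Encodable.encode_injective hi'
        exact h5
    · exact ⟨⟨⟨σ, O⟩, hO, hσ⟩, Subset.rfl, fun x hx => absurd rfl hx,
        fun i hi => absurd ⟨i, hi⟩ hk⟩
  choose next hnext_sub hnext_supp hnext_mem using hstep
  refine fun σ => (@mem_closure_iff _ (strongTopology I F V ⊤) _ _).2 fun O hO hσO => ?_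
  obtain ⟨O₁, hO₁, rfl⟩ := hO
  -- A general open set need not contain the limit. A finite intersection of subbasic sets does,
  -- since each of its conditions involves germs along one compact set.
  obtain ⟨_, ⟨𝒮, ⟨h𝒮fin, h𝒮⟩, rfl⟩, hσ𝒮, h𝒮O⟩ :=
    let := SmoothMaps.strongTopology I (I.prod 𝓘(ℝ, F)) (⊤ : Opens M) (TotalSpace F V)
    (isTopologicalBasis_of_subbasis rfl).exists_subset_of_mem_open (a := σ.1) (u := O₁) hσO hO₁
  have h𝒮open : StronglyOpen (Subtype.val ⁻¹' ⋂₀ 𝒮 : Set (LocalSection I F V (⊤ : Opens M))) :=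
    ⟨⋂₀ 𝒮, @Set.Finite.isOpen_sInter _ (SmoothMaps.strongTopology I (I.prod 𝓘(ℝ, F))
      (⊤ : Opens M) (TotalSpace F V)) _ h𝒮fin fun S hS => isOpen_generateFrom_of_mem (h𝒮 hS), rfl⟩
  let seq : ℕ → {p : LocalSection I F V (⊤ : Opens M) ×
      Set (LocalSection I F V (⊤ : Opens M)) // StronglyOpen p.2 ∧ p.1 ∈ p.2} :=
    fun k => Nat.rec ⟨⟨σ, Subtype.val ⁻¹' ⋂₀ 𝒮⟩, h𝒮open, hσ𝒮⟩ next k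
  have hanti : Antitone fun k => (seq k).1.2 := antitone_nat_of_succ_le fun k => hnext_sub k _
  have hmem : ∀ {m k : ℕ}, m ≤ k → (seq k).1.1 ∈ (seq m).1.2 :=
    fun {m k} h => hanti h (seq k).2.2
  -- Successive terms differ only on a locally finite family of sets, so the sequence is locally
  -- eventually constant.
  obtain ⟨s, hs⟩ := LocallyFinite.exists_forall_eventually_eq_prod
    (f := fun k => (seq k).1.1.extendZero)
    (fs.locallyFinite.closure.biUnion_encode.subset fun k => hnext_supp k (seq k))
  have hcompact : ∀ K : Set M, IsCompact K →
      ∀ᶠ k in atTop, ∀ᶠ x in 𝓝ˢ K, (seq k).1.1.extendZero x = s x :=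
    fun K hK => hK.eventually_forall_mem_of_prod fun x _ => hs x
  have hssm : ∀ x ∈ (⊤ : Opens M), ContMDiffAt I (I.prod 𝓘(ℝ, F)) ∞ (toTotal F s) x := by
    intro x _
    obtain ⟨k, hk⟩ := (hs x).curry.exists
    refine ((seq k).1.1.contMDiffAt_extendZero (Opens.mem_top x)).congr_of_eventuallyEq ?_
    filter_upwards [hk] with y hy
    rw [toTotal, toTotal, ← hy]
  refine ⟨LocalSection.ofFun ⊤ s hssm, h𝒮O ?_, ?_⟩
  · rintro S hS
    obtain ⟨f, κ, φ, ψ, K, r, ε, -, had, rfl⟩ := h𝒮 hS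
    refine mem_iInter.2 fun i => ?_
    obtain ⟨k, hk⟩ := (hcompact _ ((had i).2.2.1.image continuous_subtype_val)).exists
    refine SmoothMaps.mem_derivNhd_of_eventuallyEq (had i).2.2.2.1
      (mem_iInter.1 (hmem (Nat.zero_le k) _ hS) i) fun x hx => ?_
    have hx' : ∀ᶠ y in 𝓝 (x : M), (seq k).1.1.extendZero y = s y :=
      hk.filter_mono (nhds_le_nhdsSet (mem_image_of_mem _ hx))
    filter_upwards [continuous_subtype_val.continuousAt.eventually hx'] with y hy
    rw [← LocalSection.toTotal_extendZero (seq k).1.1 y]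
    change toTotal F s y = _
    rw [toTotal, toTotal, hy]
  · refine hX.mem_of_cover _ (range W') (eq_top_iff.2 fun x _ => ?_) ?_
    · obtain ⟨i, hi⟩ := fs.eventuallyEq_one' x (mem_univ x)
      refine Opens.mem_sSup.2 ⟨W' i, mem_range_self i, ?_⟩
      change 3 / 4 < fs i x
      rw [hi.self_of_nhds]
      norm_num
    · rintro _ ⟨i, rfl⟩
      -- Index `i` is treated in passing to term `encode i + 1`; every later term stays in the
      -- neighbourhood chosen there.
      obtain ⟨k, hk, hik⟩ := ((hcompact _ (hcs i)).and
        (eventually_ge_atTop (Encodable.encode i + 1))).exists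
      have h1 := hnext_mem (Encodable.encode i) (seq (Encodable.encode i)) i rfl _ (hmem hik)
      rw [LocalSection.restrict_eq_ofFun] at h1 ⊢
      convert h1 using 1
      refine LocalSection.ofFun_congr _ _ fun x hx => ?_
      rw [LocalSection.extendZero_ofFun _ (Opens.mem_top x),
        hk.self_of_nhdsSet x (hWs i (hW'W i hx))]

end SmoothSections

end

theorem mainTheorem9
    {EM : Type*} [NormedAddCommGroup EM] [NormedSpace ℝ EM] [FiniteDimensional ℝ EM]
    {HM : Type*} [TopologicalSpace HM] (I : ModelWithCorners ℝ EM HM) [I.Boundaryless]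
    {M : Type*} [TopologicalSpace M] [ChartedSpace HM M] [IsManifold I ∞ M]
    [T2Space M] [SecondCountableTopology M]
    (F : Type*) [NormedAddCommGroup F] [NormedSpace ℝ F] [FiniteDimensional ℝ F]
    (V : M → Type*) [TopologicalSpace (TotalSpace F V)] [∀ x, TopologicalSpace (V x)]
    [∀ x, AddCommGroup (V x)] [∀ x, Module ℝ (V x)]
    [FiberBundle F V] [VectorBundle ℝ F V] [ContMDiffVectorBundle ∞ F V I]
    (X : ∀ U : Opens M, Set (SmoothSections.LocalSection I F V U))
    (hX : SmoothSections.IsSmoothClass X)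
    (𝒰 : Set (Opens M)) (h𝒰 : sSup 𝒰 = ⊤)
    (hopen : ∀ W ∈ 𝒰, ∀ U ≤ W, SmoothSections.StronglyOpen (X U)) :
    SmoothSections.StronglyOpen (X ⊤) ∧
      ((∀ W ∈ 𝒰, ∀ U ≤ W, SmoothSections.WeaklyDense (X U)) →
        SmoothSections.StronglyDense (X ⊤)) := by
  exact ⟨hX.stronglyOpen_top h𝒰 fun W hW => hopen W hW W le_rfl,
    fun hdense => hX.stronglyDense_top h𝒰 hopen fun W hW => hdense W hW W le_rfl⟩
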